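/- **Nonlocal NLS hierarchies.** Throughout, $*$ denotes (entrywise) complex conjugation. For functions $q,r$ of $x$ let $$L=\begin{pmatrix}-\partial_x+2q\,\partial_x^{-1}r & 2q\,\partial_x^{-1}q\\ -2r\,\partial_x^{-1}r & \partial_x-2r\,\partial_x^{-1}q\end{pmatrix},\qquad K_m=\begin{pmatrix}K_{m,1}\\K_{m,2}\end{pmatrix}=L^m\begin{pmatrix}-q\\ r\end{pmatrix}\quad(m\ge 0),$$ where $K_{m,1},K_{m,2}$ are differential polynomials in $q,r$ and $\partial_x^{-1}$ of a total derivative is its primitive without constant term; thus $(q,r)^T_{t_m}=K_m$ is the AKNS hierarchy. For $k\ge1$ let $K_k^{\pm}[q(x),q(-x)]$ be the result of substituting $r(x)=\pm q^*(-x)$ into $-K_{2k,1}$. The nonlocal defocusing ($+$) and focusing ($-$) NLS hierarchies are $$iq_{\tau_{2k}}=K_k^{\pm}[q(x),q(-x)],\qquad k=1,2,3,\dots,\quad x,\tau_{2k}\in\mathbb R,$$ e.g. $K_1^{\pm}=q_{xx}\mp2q(x)^2q^*(-x)$. (They arise from the AKNS systems of even order $2k$ by $r(x)=\pm q^*(-x)$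 and the substitution of $i\tau_{2k}$ for the time of order $2k$.) **Theorem.** Let $n\ge0$, let $A,T$ be constant complex $(2n+2)\times(2n+2)$ matrices and $C,\overline C\in\mathbb C^{2n+2}$ constant vectors such that $$AT=TA^*,\qquad TT^*=\delta I,\qquad \overline C=TC^*,\qquad \delta=\mp1 .$$ Let $\tau=(\tau_2,\tau_4,\dots)$ be real numbers, put $t_{2j}=-2^{2j-1}i\tau_{2j}$, suppose that $\sum_{j\ge1}A^{2j}t_{2j}$ converges absolutely (for instance, that only finitely many $\tau_{2j}$ are non-zero), and let $$\varphi=\exp\Bigl(Ax+\sum_{j=1}^{\infty}A^{2j}t_{2j}\Bigr)C,\qquad \psi=\exp\Bigl(-Ax-\sum_{j=1}^{\infty}A^{2j}t_{2j}\Bigr)\overline C .$$ Write $|\widehat\varphi^{(a)};\widehat\psi^{(b)}|=\det(\varphi,\partial_x\varphi,\dots,\partial_x^{a}\varphi;\psi,\partial_x\psi,\dots,\partial_x^{b}\psi)$ for $a+b=2n$ (no column of $\varphi$, respectively $\psi$, if $a=-1$, respectively $b=-1$), and put $$q=2\,\frac{|\widehat\varphi^{(n+1)};\widehat\psi^{(n-1)}|}{|\widehat\varphi^{(n)};\widehat\psi^{(n)}|},\qquad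 r=-2\,\frac{|\widehat\varphi^{(n-1)};\widehat\psi^{(n+1)}|}{|\widehat\varphi^{(n)};\widehat\psi^{(n)}|}.$$ Then $\psi(x)=T\varphi^*(-x)$ for all $x\in\mathbb R$ and, at every point where $|\widehat\varphi^{(n)};\widehat\psi^{(n)}|\ne0$, one has $r(x)=\pm q^*(-x)$ and, for every $k\ge1$, $q$ is smooth in $(x,\tau_{2k})$ near the points with space coordinates $x$ and $-x$ and satisfies $iq_{\tau_{2k}}=K_k^{\pm}[q(x),q(-x)]$. Here the upper signs ($\delta=-1$, $K_k^+$) belong together, and so do the lower ones ($\delta=1$, $K_k^-$). -/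

import Mathlib

open scoped ContDiff

noncomputable section

namespace NonlocalNLS

/-! ### The AKNS hierarchy as a sequence of differential polynomials -/

/-- Differential polynomials in two functions `q`, `r` of `x`:
`Sum.inl j` stands for `∂ₓ^j q` and `Sum.inr j` for `∂ₓ^j r`. -/
abbrev DiffPoly : Type := MvPolynomial (ℕ ⊕ ℕ) ℂ

/-- The indeterminate `q`. -/
def qVar : DiffPoly := MvPolynomial.X (Sum.inl 0)

/-- The indeterminate `r`. -/
def rVar : DiffPoly := MvPolynomial.X (Sum.inr 0)

/-- The total derivative `∂ₓ`, with `∂ₓ (∂ₓ^j q) = ∂ₓ^(j+1) q`, and likewise for `r`. -/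
def dx : Derivation ℂ DiffPoly DiffPoly :=
  MvPolynomial.mkDerivation ℂ
    (Sum.elim (fun j => MvPolynomial.X (Sum.inl (j + 1)))
      (fun j => MvPolynomial.X (Sum.inr (j + 1))))

open Classical in
/-- The formal inverse `∂ₓ⁻¹`: the primitive of `p` with zero constant term (the only one, see
`eq_of_dx_eq`), and `0` if `p` is not a total derivative. -/
def dxInv (p : DiffPoly) : DiffPoly :=
  if h : ∃ w : DiffPoly, MvPolynomial.constantCoeff w = 0 ∧ dx w = p then h.choose else 0

section

open MvPolynomial

theorem pderiv_dx_inl (j : ℕ) (w : DiffPoly) :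
    pderiv (Sum.inl (j+1)) (dx w) = dx (pderiv (Sum.inl (j+1)) w) + pderiv (Sum.inl j) w := by
  induction w using MvPolynomial.induction_on with
  | C a => simp [dx]
  | add p q hp hq => simp only [map_add, hp, hq]; ring
  | mul_X p i hp =>
    have h : pderiv (Sum.inl (j+1)) (dx (X i)) = (pderiv (Sum.inl j) (X i) : DiffPoly) := by
      rcases i with i | i <;> simp [dx, pderiv_X, Pi.single_apply]
    have h2 : dx (pderiv (Sum.inl (j+1)) (X i : DiffPoly)) = 0 := by
      rw [pderiv_X]; by_cases hi : i = Sum.inl (j+1) <;> simp [hi]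
    simp only [Derivation.leibniz, map_add, hp, smul_eq_mul, h, h2]; ring
theorem pderiv_dx_inr (j : ℕ) (w : DiffPoly) :
    pderiv (Sum.inr (j+1)) (dx w) = dx (pderiv (Sum.inr (j+1)) w) + pderiv (Sum.inr j) w := by
  induction w using MvPolynomial.induction_on with
  | C a => simp [dx]
  | add p q hp hq => simp only [map_add, hp, hq]; ring
  | mul_X p i hp =>
    have h : pderiv (Sum.inr (j+1)) (dx (X i)) = (pderiv (Sum.inr j) (X i) : DiffPoly) := by
      rcases i with i | i <;> simp [dx, pderiv_X, Pi.single_apply]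
    have h2 : dx (pderiv (Sum.inr (j+1)) (X i : DiffPoly)) = 0 := by
      rw [pderiv_X]; by_cases hi : i = Sum.inr (j+1) <;> simp [hi]
    simp only [Derivation.leibniz, map_add, hp, smul_eq_mul, h, h2]; ring

theorem eq_C_of_pderiv (w : DiffPoly) (h : ∀ i, pderiv i w = 0) : w = C (constantCoeff w) := by
  ext m
  rw [coeff_C]
  split_ifs with hm
  · subst hm; rfl
  · obtain ⟨i, hi⟩ : ∃ i, m i ≠ 0 := by
      by_contra hc; push Not at hc; exact hm (by ext i; simp [hc])
    have := congrArg (coeff (m - Finsupp.single i 1)) (h i)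
    rw [coeff_pderiv] at this
    have hle : Finsupp.single i 1 ≤ m := by simpa using Nat.one_le_iff_ne_zero.mpr hi
    rw [tsub_add_cancel_of_le hle] at this
    simp only [coeff_zero, mul_eq_zero] at this
    rcases this with h | h
    · exact h
    · exact absurd h (by norm_cast)

/-- The kernel of `∂ₓ` consists of the constants. -/
theorem dx_ker (w : DiffPoly) (h : dx w = 0) : w = C (constantCoeff w) := by
  apply eq_C_of_pderiv
  have hb : ∃ N : ℕ, ∀ j ≥ N, pderiv (Sum.inl j) w = 0 ∧ pderiv (Sum.inr j) w = 0 := by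
    refine ⟨w.vars.sup (Sum.elim id id) + 1, fun j hj => ⟨?_, ?_⟩⟩
    · refine pderiv_eq_zero_of_notMem_vars fun hm => ?_
      have := Finset.le_sup (f := Sum.elim id id) hm; simp at this; omega
    · refine pderiv_eq_zero_of_notMem_vars fun hm => ?_
      have := Finset.le_sup (f := Sum.elim id id) hm; simp at this; omega
  obtain ⟨N, hN⟩ := hb
  have key : ∀ d j, j + d ≥ N → pderiv (Sum.inl j) w = 0 ∧ pderiv (Sum.inr j) w = 0 := by
    intro d
    induction d with
    | zero => intro j hj; exact hN j (by omega)
    | succ d ih =>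
      intro j hj
      obtain ⟨h1, h2⟩ := ih (j+1) (by omega)
      have e1 := pderiv_dx_inl j w
      have e2 := pderiv_dx_inr j w
      simp only [h, h1, h2, map_zero, zero_add] at e1 e2
      exact ⟨e1.symm, e2.symm⟩
  rintro (j | j)
  · exact (key N j (by omega)).1
  · exact (key N j (by omega)).2

/-- Primitives with zero constant term are unique. -/
theorem eq_of_dx_eq (v w : DiffPoly) (hv : constantCoeff v = 0) (hw : constantCoeff w = 0)
    (h : dx v = dx w) : v = w := by
  have := dx_ker (v - w) (by simp [h])
  simpa [hv, hw, sub_eq_zero] using this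

theorem dxInv_eq (w p : DiffPoly) (h0 : constantCoeff w = 0) (h : dx w = p) : dxInv p = w := by
  have hex : ∃ w : DiffPoly, constantCoeff w = 0 ∧ dx w = p := ⟨w, h0, h⟩
  rw [dxInv, dif_pos hex]
  exact eq_of_dx_eq _ _ hex.choose_spec.1 h0 (hex.choose_spec.2.trans h.symm)

end

/-- The AKNS recursion operator
`L = [[-∂ₓ + 2q ∂ₓ⁻¹ r, 2q ∂ₓ⁻¹ q], [-2r ∂ₓ⁻¹ r, ∂ₓ - 2r ∂ₓ⁻¹ q]]` acting on pairs. -/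
def recursionOp (P : DiffPoly × DiffPoly) : DiffPoly × DiffPoly :=
  (-dx P.1 + 2 * qVar * dxInv (rVar * P.1 + qVar * P.2),
    dx P.2 - 2 * rVar * dxInv (rVar * P.1 + qVar * P.2))

/-- The AKNS flows `K_m = L^m (-q, r)`; the `m`-th AKNS system is `(q, r)_{t_m} = K_m`. -/
def aknsFlow (m : ℕ) : DiffPoly × DiffPoly := recursionOp^[m] (-qVar, rVar)

/-- The value at `x` of a differential polynomial in the functions `q` and `r`. -/
def evalAt (p : DiffPoly) (q r : ℝ → ℂ) (x : ℝ) : ℂ :=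
  MvPolynomial.eval (Sum.elim (fun j => iteratedDeriv j q x) (fun j => iteratedDeriv j r x)) p

/-! ### The nonlocal NLS hierarchies -/

/-- The reduced potential `r(x) = ε q*(-x)`. -/
def reflected (ε : ℂ) (q : ℝ → ℂ) (x : ℝ) : ℂ := ε * star (q (-x))

/-- The right-hand side `K_k^±` of `i q_{τ_{2k}} = K_k^±[q(x), q(-x)]`, with `ε = ±1`. It is what
the first component `q_{t_{2k}} = K_{2k,1}` of the AKNS system of order `2k` becomes under
`r(x) = ε q*(-x)`, `t_{2k} = i τ_{2k}`, since then `i q_{τ_{2k}} = -q_{t_{2k}}`. -/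
def nlsFlow (ε : ℂ) (k : ℕ) (q : ℝ → ℂ) (x : ℝ) : ℂ :=
  -evalAt (aknsFlow (2 * k)).1 q (reflected ε q) x

/-- `q`, a function of the times `τ = (τ_2, τ_4, …)` (where `τ j` is `τ_{2j}`, `j ≥ 1`) and of `x`,
satisfies `i q_{τ_{2k}} = K_k^±[q(x), q(-x)]` at the point `(τ, x)`, being smooth in `(x, τ_{2k})`
near the two points `±x` that enter the equation. -/
def SolvesAt (ε : ℂ) (k : ℕ) (q : (ℕ → ℝ) → ℝ → ℂ) (τ : ℕ → ℝ) (x : ℝ) : Prop :=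
  ContDiffAt ℝ ∞ (fun p : ℝ × ℝ => q (Function.update τ k p.2) p.1) (x, τ k) ∧
  ContDiffAt ℝ ∞ (fun p : ℝ × ℝ => q (Function.update τ k p.2) p.1) (-x, τ k) ∧
  Complex.I * deriv (fun s : ℝ => q (Function.update τ k s) x) (τ k) = nlsFlow ε k (q τ) x

/-! ### Double Wronskians -/

/-- The determinant of the `N × N` matrix
`(φ, ∂ₓφ, …, ∂ₓ^(p-1) φ; ψ, ∂ₓψ, …, ∂ₓ^(N-p-1) ψ)`. -/
def doubleWronskian {N : ℕ} (p : ℕ) (φ ψ : ℝ → Fin N → ℂ) (x : ℝ) : ℂ :=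
  Matrix.det (Matrix.of fun i j : Fin N =>
    if (j : ℕ) < p then iteratedDeriv (j : ℕ) (fun y => φ y i) x
    else iteratedDeriv ((j : ℕ) - p) (fun y => ψ y i) x)

/-- The matrix `A x + ∑_{j ≥ 1} A^(2j) t_{2j}`, where `t j` is `t_{2j}`. -/
def exponent {N : ℕ} (A : Matrix (Fin N) (Fin N) ℂ) (t : ℕ → ℂ) (x : ℝ) :
    Matrix (Fin N) (Fin N) ℂ :=
  (x : ℂ) • A + ∑' j : ℕ, t (j + 1) • A ^ (2 * (j + 1))

/-- `φ = exp(A x + ∑ A^(2j) t_{2j}) C`. -/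
def phi {N : ℕ} (A : Matrix (Fin N) (Fin N) ℂ) (C : Fin N → ℂ) (t : ℕ → ℂ) (x : ℝ) : Fin N → ℂ :=
  Matrix.mulVec (NormedSpace.exp (exponent A t x)) C

/-- `ψ = exp(-A x - ∑ A^(2j) t_{2j}) D`. -/
def psi {N : ℕ} (A : Matrix (Fin N) (Fin N) ℂ) (D : Fin N → ℂ) (t : ℕ → ℂ) (x : ℝ) : Fin N → ℂ :=
  Matrix.mulVec (NormedSpace.exp (-exponent A t x)) D

/-- The times `t_{2j} = -2^(2j-1) i τ_{2j}`. -/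
def times (τ : ℕ → ℝ) (j : ℕ) : ℂ := -((2 : ℂ) ^ (2 * j) / 2) * Complex.I * (τ j : ℂ)

/-- The double Wronskian with `p` columns from `φ` and the remaining ones from `ψ`, at real times
`τ`. -/
def W {N : ℕ} (A : Matrix (Fin N) (Fin N) ℂ) (C D : Fin N → ℂ) (p : ℕ) (τ : ℕ → ℝ) (x : ℝ) : ℂ :=
  doubleWronskian p (phi A C (times τ)) (psi A D (times τ)) x

/-- `q = 2 |φ^(n+1); ψ^(n-1)| / |φ^(n); ψ^(n)|`. -/
def qSol {n : ℕ} (A : Matrix (Fin (2 * n + 2)) (Fin (2 * n + 2)) ℂ) (C D : Fin (2 * n + 2) → ℂ)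
    (τ : ℕ → ℝ) (x : ℝ) : ℂ :=
  2 * W A C D (n + 2) τ x / W A C D (n + 1) τ x

/-- `r = -2 |φ^(n-1); ψ^(n+1)| / |φ^(n); ψ^(n)|`. -/
def rSol {n : ℕ} (A : Matrix (Fin (2 * n + 2)) (Fin (2 * n + 2)) ℂ) (C D : Fin (2 * n + 2) → ℂ)
    (τ : ℕ → ℝ) (x : ℝ) : ℂ :=
  -2 * W A C D n τ x / W A C D (n + 1) τ x

end NonlocalNLS

end

/-! Put σ = diag(1, -1) and U = [[0, q], [r, 0]]. The AKNS hierarchy is encoded in the formal series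
S = σ + O(λ⁻¹) with S² = 1 and S_x = [λσ + U, S]. These equations determine the coefficients of S
recursively as differential polynomials (`laxCoeff`), and K_m = (-2)^m (-b_{m+1}, c_{m+1}) by
`aknsFlow_eq`. It remains to produce such an S for the given q, r and to express q_τ through it.

S is obtained by dressing. Where the double Wronskian does not vanish there is a unique 2×2 matrix
polynomial G = λ^(n+1) (1 + O(λ⁻¹)) with G(A) (φ, ψ)ᵀ = 0, and by Cramer's rule q and r are -2 and 2
times its off-diagonal λ⁻¹ coefficients (`coeff_one_dressB`, `coeff_one_dressC`). Along a flow φ' =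
κ A^m φ, ψ' = -κ A^m ψ, differentiate the annihilation relation and subtract a suitable combination
of the rows of G: what is left has λ-degree at most n and still annihilates (φ, ψ), so it vanishes
(`row_flow`). For the x-flow this says G_x = (λσ + U) G - λ G σ, so S = G σ G⁻¹ solves the Lax
equation (`hasDerivAt_coeff_conj`) and its coefficients are the universal ones
(`coeff_eq_evalAt_laxCoeff`). For the flow of τ_{2k} it says that q moves by 2κ b_{2k+1}
(`hasDerivAt_qSol_time`).

The reduction uses the same uniqueness. Conjugation followed by T carries the annihilation relation
at -x to one at x and interchanges the rows of G up to δ, so r(x) = -δ q*(-x)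
(`coeff_one_dressC_reflected`). -/

noncomputable section

namespace NonlocalNLS

/-! ### The AKNS flows as coefficients of the formal solution of the Lax equation. -/

section DiffPoly

open PowerSeries Finset

/-- The coefficients `(a_j, b_j, c_j)` of the formal solution `S = [[a, b], [c, -a]]` of
`S² = 1`, `S_x = [λσ + U, S]`, `U = [[0, q], [r, 0]]`, in powers of `λ⁻¹`. -/
def laxCoeff : ℕ → DiffPoly × DiffPoly × DiffPoly
  | 0 => (1, 0, 0)
  | j + 1 =>
    (-(MvPolynomial.C (1 / 2) * (∑ i : Fin j, (laxCoeff (i + 1)).1 * (laxCoeff (j - i)).1 +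
        ∑ i : Fin j, (laxCoeff (i + 1)).2.1 * (laxCoeff (j - i)).2.2)),
      MvPolynomial.C (1 / 2) * dx (laxCoeff j).2.1 + qVar * (laxCoeff j).1,
      -(MvPolynomial.C (1 / 2) * dx (laxCoeff j).2.2) + rVar * (laxCoeff j).1)
  decreasing_by all_goals omega

theorem two_mul_C_half : (2 : DiffPoly) * MvPolynomial.C (1 / 2) = 1 := by
  rw [← map_ofNat (MvPolynomial.C : ℂ →+* DiffPoly) 2, ← map_mul]
  norm_num

theorem two_mul_laxCoeff_b_succ (j : ℕ) :
    2 * (laxCoeff (j + 1)).2.1 = dx (laxCoeff j).2.1 + 2 * qVar * (laxCoeff j).1 := by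
  rw [laxCoeff]
  linear_combination dx (laxCoeff j).2.1 * two_mul_C_half

theorem two_mul_laxCoeff_c_succ (j : ℕ) :
    2 * (laxCoeff (j + 1)).2.2 = -dx (laxCoeff j).2.2 + 2 * rVar * (laxCoeff j).1 := by
  rw [laxCoeff]
  linear_combination -dx (laxCoeff j).2.2 * two_mul_C_half

/-- Coefficient `j + 1` of a product, with the extreme terms split off. -/
theorem coeff_succ_mul {R : Type*} [CommRing R] (f g : PowerSeries R) (j : ℕ) :
    coeff (j + 1) (f * g) = coeff 0 f * coeff (j + 1) g + coeff (j + 1) f * coeff 0 g +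
      ∑ i : Fin j, coeff (i + 1) f * coeff (j - i) g := by
  rw [coeff_mul, Finset.Nat.sum_antidiagonal_eq_sum_range_succ
    (f := fun a b => coeff a f * coeff b g), Finset.sum_range_succ', Finset.sum_range_succ,
    Fin.sum_univ_eq_sum_range (fun i => coeff (i + 1) f * coeff (j - i) g) j]
  simp only [Nat.add_sub_add_right, Nat.sub_self, Nat.sub_zero]
  ring

/-- The generating series of the `a_j`. -/
def laxA : PowerSeries DiffPoly := PowerSeries.mk fun j => (laxCoeff j).1
/-- The generating series of the `b_j`. -/
def laxB : PowerSeries DiffPoly := PowerSeries.mk fun j => (laxCoeff j).2.1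
/-- The generating series of the `c_j`. -/
def laxC : PowerSeries DiffPoly := PowerSeries.mk fun j => (laxCoeff j).2.2

theorem laxA_sq_add : laxA * laxA + laxB * laxC = 1 := by
  ext1 j
  cases j with
  | zero => simp [laxA, laxB, laxC, laxCoeff]
  | succ j =>
    rw [map_add, coeff_succ_mul, coeff_succ_mul]
    simp only [laxA, laxB, laxC, coeff_mk, coeff_one, Nat.succ_ne_zero, if_false]
    have h := two_mul_C_half
    rw [show laxCoeff 0 = (1, 0, 0) by rw [laxCoeff], laxCoeff]
    linear_combination -(∑ i : Fin j, (laxCoeff (i + 1)).1 * (laxCoeff (j - i)).1 +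
        ∑ i : Fin j, (laxCoeff (i + 1)).2.1 * (laxCoeff (j - i)).2.2) * h

/-- The total derivative, applied coefficientwise to a power series. -/
def dxSeries (f : PowerSeries DiffPoly) : PowerSeries DiffPoly :=
  PowerSeries.mk fun j => dx (coeff j f)

theorem dxSeries_add (f g : PowerSeries DiffPoly) :
    dxSeries (f + g) = dxSeries f + dxSeries g := by
  ext1 j; simp [dxSeries]

theorem dxSeries_mul (f g : PowerSeries DiffPoly) :
    dxSeries (f * g) = dxSeries f * g + f * dxSeries g := by
  ext1 j
  simp only [dxSeries, coeff_mk, map_add, coeff_mul, map_sum, Derivation.leibniz, smul_eq_mul,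
    ← Finset.sum_add_distrib]
  exact Finset.sum_congr rfl fun _ _ => by ring

theorem dxSeries_one : dxSeries 1 = 0 := by
  ext1 j
  simp only [dxSeries, coeff_mk, coeff_one, map_zero]
  split_ifs <;> simp

/-- `X` stands for λ⁻¹: this is the upper right entry of S_x = [λσ + U, S], multiplied by λ⁻¹. -/
theorem X_mul_dxSeries_laxB : X * dxSeries laxB = 2 * laxB - 2 * X * C qVar * laxA := by
  ext1 j
  rw [map_sub, mul_assoc 2, mul_assoc 2, two_mul, two_mul, map_add, map_add, mul_assoc X]
  cases j with
  | zero => simp [laxB, laxCoeff]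
  | succ j =>
    simp only [coeff_succ_X_mul, coeff_C_mul, dxSeries, laxA, laxB, coeff_mk]
    linear_combination -two_mul_laxCoeff_b_succ j

theorem X_mul_dxSeries_laxC : X * dxSeries laxC = -(2 * laxC) + 2 * X * C rVar * laxA := by
  ext1 j
  rw [map_add, mul_assoc 2, mul_assoc 2, two_mul, two_mul, map_neg, map_add, map_add, mul_assoc X]
  cases j with
  | zero => simp [laxC, laxCoeff]
  | succ j =>
    simp only [coeff_succ_X_mul, coeff_C_mul, dxSeries, laxA, laxC, coeff_mk]
    linear_combination two_mul_laxCoeff_c_succ j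

theorem laxA_ne_zero : laxA ≠ 0 := by
  intro h
  have := congrArg (coeff 0) h
  simp [laxA, laxCoeff] at this

/-- The diagonal Lax equation is not part of the recursion. It follows by differentiating S² = 1,
inserting the two off-diagonal equations and cancelling 2 λ⁻¹ a in the domain of power series. -/
theorem dxSeries_laxA : dxSeries laxA = C qVar * laxC - C rVar * laxB := by
  have h := congrArg dxSeries laxA_sq_add
  rw [dxSeries_one, dxSeries_add, dxSeries_mul, dxSeries_mul] at h
  have h2 : 2 * laxA * X * (dxSeries laxA - (C qVar * laxC - C rVar * laxB)) = 0 := by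
    linear_combination X * h - laxC * X_mul_dxSeries_laxB - laxB * X_mul_dxSeries_laxC
  have h0 : (2 * laxA * X : PowerSeries DiffPoly) ≠ 0 := by
    refine mul_ne_zero (mul_ne_zero (fun h => ?_) laxA_ne_zero) X_ne_zero
    have := congrArg (coeff 0) h
    rw [← map_ofNat (C : DiffPoly →+* PowerSeries DiffPoly) 2] at this
    simp at this
  exact sub_eq_zero.mp ((mul_eq_zero.mp h2).resolve_left h0)

/-- This makes the argument of ∂ₓ⁻¹ in the recursion operator a total derivative at every stage, so
`dxInv` never falls back on its default value along the hierarchy. -/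
theorem dx_laxCoeff_a (j : ℕ) :
    dx (laxCoeff j).1 = qVar * (laxCoeff j).2.2 - rVar * (laxCoeff j).2.1 := by
  have := congrArg (coeff j) dxSeries_laxA
  simpa [dxSeries, laxA, laxB, laxC] using this

theorem constantCoeff_dx (p : DiffPoly) : MvPolynomial.constantCoeff (dx p) = 0 := by
  induction p using MvPolynomial.induction_on with
  | C a => simp [dx]
  | add p q hp hq => simp [hp, hq]
  | mul_X p i hp =>
    rcases i with i | i <;> simp [dx] at hp ⊢

theorem constantCoeff_laxCoeff_b (j : ℕ) :
    MvPolynomial.constantCoeff (laxCoeff j).2.1 = 0 := by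
  cases j with
  | zero => simp [laxCoeff]
  | succ j => rw [laxCoeff]; simp [constantCoeff_dx, qVar]

/-- The shift matters: a_0 = 1 has a constant term, whereas every later a_j is the primitive
selected by `dxInv`. -/
theorem constantCoeff_laxCoeff_a (j : ℕ) :
    MvPolynomial.constantCoeff (laxCoeff (j + 1)).1 = 0 := by
  induction j using Nat.strong_induction_on with
  | _ j ih =>
    rw [laxCoeff]
    have h1 : ∀ i : Fin j, MvPolynomial.constantCoeff (laxCoeff (i + 1)).1 = 0 :=
      fun i => ih i i.2
    simp [constantCoeff_laxCoeff_b, h1]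

/-- Applying L to (-b_{m+1}, c_{m+1}) integrates q c_{m+1} - r b_{m+1} to a_{m+1}. The recursion for
b and c then turns the result into -2 (-b_{m+2}, c_{m+2}). -/
theorem aknsFlow_eq (m : ℕ) :
    aknsFlow m = (-((-2) ^ m * (laxCoeff (m + 1)).2.1), (-2) ^ m * (laxCoeff (m + 1)).2.2) := by
  induction m with
  | zero =>
    have hb := two_mul_laxCoeff_b_succ 0
    have hc := two_mul_laxCoeff_c_succ 0
    rw [show laxCoeff 0 = (1, 0, 0) by rw [laxCoeff]] at hb hc
    have h2 : (2 : DiffPoly) ≠ 0 := two_ne_zero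
    ext1
    · refine mul_left_cancel₀ h2 ?_
      simp only [aknsFlow, Function.iterate_zero, id, map_zero] at hb ⊢
      linear_combination hb
    · refine mul_left_cancel₀ h2 ?_
      simp only [aknsFlow, Function.iterate_zero, id, map_zero] at hc ⊢
      linear_combination -hc
  | succ m ih =>
    rw [aknsFlow, Function.iterate_succ_apply', ← aknsFlow, ih, recursionOp]
    have hpow : ((-2 : DiffPoly)) ^ m = MvPolynomial.C ((-2) ^ m) := by
      rw [map_pow, map_neg, map_ofNat]
    have hdx : ∀ p, dx ((-2) ^ m * p) = (-2) ^ m * dx p := fun p => by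
      rw [hpow, ← MvPolynomial.smul_eq_C_mul, Derivation.map_smul, MvPolynomial.smul_eq_C_mul]
    have hinv : dxInv (rVar * -((-2) ^ m * (laxCoeff (m + 1)).2.1) +
        qVar * ((-2) ^ m * (laxCoeff (m + 1)).2.2)) = (-2) ^ m * (laxCoeff (m + 1)).1 := by
      refine dxInv_eq _ _ (by simp [constantCoeff_laxCoeff_a]) ?_
      rw [hdx, dx_laxCoeff_a]; ring
    simp only [hinv, map_neg, hdx]
    have hb := two_mul_laxCoeff_b_succ (m + 1)
    have hc := two_mul_laxCoeff_c_succ (m + 1)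
    ext1
    · simp only; linear_combination -(-2) ^ m * hb
    · simp only; linear_combination (-2) ^ m * hc

end DiffPoly

/-! ### The dressing matrix, its uniqueness, and Cramer's formulas for q and r. -/

section Dressing

open Polynomial Matrix

/-- The value at `A` of the reversed polynomial `λ^d f(1/λ)`. -/
def revEval {N : ℕ} (A : Matrix (Fin N) (Fin N) ℂ) (d : ℕ) (f : ℂ[X]) : Matrix (Fin N) (Fin N) ℂ :=
  aeval A (reflect d f)

section revEval

variable {N : ℕ} (A : Matrix (Fin N) (Fin N) ℂ)

theorem revEval_add (d : ℕ) (f g : ℂ[X]) : revEval A d (f + g) = revEval A d f + revEval A d g := by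
  simp [revEval, reflect_add]

theorem revEval_sub (d : ℕ) (f g : ℂ[X]) : revEval A d (f - g) = revEval A d f - revEval A d g := by
  simp [revEval, reflect_sub]

theorem revEval_neg (d : ℕ) (f : ℂ[X]) : revEval A d (-f) = -revEval A d f := by
  simp [revEval, reflect_neg]

theorem revEval_C_mul (d : ℕ) (c : ℂ) (f : ℂ[X]) : revEval A d (C c * f) = c • revEval A d f := by
  simp [revEval, reflect_C_mul, Algebra.smul_def]

theorem revEval_sum {ι : Type*} (d : ℕ) (s : Finset ι) (f : ι → ℂ[X]) :
    revEval A d (∑ i ∈ s, f i) = ∑ i ∈ s, revEval A d (f i) :=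
  map_sum (AddMonoidHom.mk' (revEval A d) (revEval_add A d)) f s

theorem revEval_monomial {d j : ℕ} (hj : j ≤ d) (c : ℂ) :
    revEval A d (monomial j c) = c • A ^ (d - j) := by
  rw [revEval, ← C_mul_X_pow_eq_monomial, reflect_C_mul_X_pow, revAt_le hj]
  simp [Algebra.smul_def]

theorem revEval_mul {d e : ℕ} {f g : ℂ[X]} (hf : f.natDegree ≤ d) (hg : g.natDegree ≤ e) :
    revEval A (d + e) (f * g) = revEval A d f * revEval A e g := by
  rw [revEval, reflect_mul _ _ hf hg, map_mul]; rfl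

theorem revEval_one (d : ℕ) : revEval A d 1 = A ^ d := by
  have := revEval_monomial A (Nat.zero_le d) 1
  simpa using this

theorem revEval_X_pow (d : ℕ) : revEval A d (X ^ d) = 1 := by
  have := revEval_monomial A (le_refl d) 1
  rw [monomial_one_right_eq_X_pow] at this
  simpa using this

theorem revEval_X_pow_mul (m : ℕ) {d : ℕ} {f : ℂ[X]} (hf : f.natDegree ≤ d) :
    revEval A (m + d) (X ^ m * f) = revEval A d f := by
  rw [revEval_mul A (natDegree_X_pow_le m) hf, revEval_X_pow, one_mul]

theorem revEval_one_add_X_mul {d : ℕ} {f : ℂ[X]} (hf : f.natDegree ≤ d) :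
    revEval A (d + 1) (1 + X * f) = A ^ (d + 1) + revEval A d f := by
  have := revEval_X_pow_mul A 1 hf
  rw [pow_one, add_comm 1 d] at this
  rw [revEval_add, revEval_one, this]

theorem revEval_eq_sum {d : ℕ} {f : ℂ[X]} (hf : f.natDegree ≤ d) :
    revEval A d f = ∑ j ∈ Finset.range (d + 1), f.coeff j • A ^ (d - j) := by
  conv_lhs => rw [as_sum_range' f (d + 1) (by omega)]
  rw [revEval_sum]
  exact Finset.sum_congr rfl fun j hj =>
    revEval_monomial A (by have := Finset.mem_range.mp hj; omega) _

end revEval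

/-- The columns `φ, Aφ, …, A^(p-1) φ, ψ, -Aψ, (-A)²ψ, …`. -/
def krylovMatrix {N : ℕ} (A : Matrix (Fin N) (Fin N) ℂ) (p : ℕ) (φ ψ : Fin N → ℂ) :
    Matrix (Fin N) (Fin N) ℂ :=
  Matrix.of fun i j : Fin N =>
    if (j : ℕ) < p then (A ^ (j : ℕ) *ᵥ φ) i else ((-A) ^ ((j : ℕ) - p) *ᵥ ψ) i

variable {n : ℕ}

/-- The two halves of `Fin (2n+2)`. -/
def halves (n : ℕ) : Fin (n + 1) ⊕ Fin (n + 1) ≃ Fin (2 * n + 2) :=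
  finSumFinEquiv.trans (finCongr (by omega))

@[simp] theorem halves_inl_val (j : Fin (n + 1)) : (halves n (Sum.inl j) : ℕ) = j := by
  simp [halves]

@[simp] theorem halves_inr_val (j : Fin (n + 1)) : (halves n (Sum.inr j) : ℕ) = n + 1 + j := by
  simp [halves, add_comm]

/-- The polynomial whose reversed coefficients are the first half of `w`. -/
def topPoly (w : Fin (2 * n + 2) → ℂ) : ℂ[X] :=
  ∑ j : Fin (n + 1), monomial (n - j) (w (halves n (Sum.inl j)))

/-- The polynomial whose reversed coefficients are, up to sign, the second half of `w`. -/
def botPoly (w : Fin (2 * n + 2) → ℂ) : ℂ[X] :=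
  ∑ j : Fin (n + 1), monomial (n - j) ((-1) ^ (j : ℕ) * w (halves n (Sum.inr j)))

theorem coeff_topPoly (w : Fin (2 * n + 2) → ℂ) (j : Fin (n + 1)) :
    (topPoly w).coeff (n - j) = w (halves n (Sum.inl j)) := by
  rw [topPoly, finsetSum_coeff, Finset.sum_eq_single j]
  · simp
  · intro b _ hb
    rw [coeff_monomial, if_neg]
    intro h; apply hb; ext; omega
  · simp

theorem coeff_botPoly (w : Fin (2 * n + 2) → ℂ) (j : Fin (n + 1)) :
    (botPoly w).coeff (n - j) = (-1) ^ (j : ℕ) * w (halves n (Sum.inr j)) := by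
  rw [botPoly, finsetSum_coeff, Finset.sum_eq_single j]
  · simp
  · intro b _ hb
    rw [coeff_monomial, if_neg]
    intro h; apply hb; ext; omega
  · simp

theorem natDegree_topPoly_le (w : Fin (2 * n + 2) → ℂ) : (topPoly w).natDegree ≤ n :=
  natDegree_sum_le_of_forall_le _ _ fun _ _ => (natDegree_monomial_le _).trans (by omega)

theorem natDegree_botPoly_le (w : Fin (2 * n + 2) → ℂ) : (botPoly w).natDegree ≤ n :=
  natDegree_sum_le_of_forall_le _ _ fun _ _ => (natDegree_monomial_le _).trans (by omega)

theorem exists_topPoly_botPoly {f g : ℂ[X]} (hf : f.natDegree ≤ n) (hg : g.natDegree ≤ n) :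
    ∃ w : Fin (2 * n + 2) → ℂ, topPoly w = f ∧ botPoly w = g := by
  have key : ∀ {p p' : ℂ[X]}, p.natDegree ≤ n → p'.natDegree ≤ n →
      (∀ j : Fin (n + 1), p.coeff (n - j) = p'.coeff (n - j)) → p = p' := by
    intro p p' hp hp' h
    ext i
    by_cases hi : i ≤ n
    · have := h ⟨n - i, by omega⟩
      simpa [Nat.sub_sub_self hi] using this
    · rw [coeff_eq_zero_of_natDegree_lt (by omega), coeff_eq_zero_of_natDegree_lt (by omega)]
  refine ⟨fun i => Sum.elim (fun j : Fin (n + 1) => f.coeff (n - j))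
    (fun j : Fin (n + 1) => (-1) ^ (j : ℕ) * g.coeff (n - j)) ((halves n).symm i), ?_, ?_⟩
  · exact key (natDegree_topPoly_le _) hf fun j => by rw [coeff_topPoly]; simp
  · refine key (natDegree_botPoly_le _) hg fun j => ?_
    rw [coeff_botPoly]; simp [← mul_assoc, ← mul_pow]

variable (A : Matrix (Fin (2 * n + 2)) (Fin (2 * n + 2)) ℂ) (φ ψ : Fin (2 * n + 2) → ℂ)

/-- Linear combinations of the Krylov columns are pairs of polynomials of degree at most n in A. The
signs in `botPoly` absorb those of the columns (-A)^j ψ. -/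
theorem krylovMatrix_mulVec (w : Fin (2 * n + 2) → ℂ) :
    krylovMatrix A (n + 1) φ ψ *ᵥ w =
      revEval A n (topPoly w) *ᵥ φ + revEval A n (botPoly w) *ᵥ ψ := by
  have ht : revEval A n (topPoly w) =
      ∑ j : Fin (n + 1), w (halves n (Sum.inl j)) • A ^ (j : ℕ) := by
    rw [topPoly, revEval_sum]
    refine Finset.sum_congr rfl fun j _ => ?_
    rw [revEval_monomial A (by omega), Nat.sub_sub_self (by omega)]
  have hb : revEval A n (botPoly w) =
      ∑ j : Fin (n + 1), w (halves n (Sum.inr j)) • (-A) ^ (j : ℕ) := by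
    rw [botPoly, revEval_sum]
    refine Finset.sum_congr rfl fun j _ => ?_
    rw [revEval_monomial A (by omega), Nat.sub_sub_self (by omega), neg_pow A]
    rcases Nat.even_or_odd (j : ℕ) with h | h <;> simp [h.neg_one_pow]
  simp only [ht, hb, Matrix.sum_mulVec, smul_mulVec]
  ext i
  rw [mulVec, dotProduct]
  simp only [krylovMatrix, Matrix.of_apply]
  rw [← (halves n).sum_comp, Fintype.sum_sum_type]
  simp only [Pi.add_apply, Finset.sum_apply]
  congr 1
  · refine Finset.sum_congr rfl fun j _ => ?_
    rw [halves_inl_val, if_pos j.2, Pi.smul_apply, smul_eq_mul,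
      mul_comm]
  · refine Finset.sum_congr rfl fun j _ => ?_
    rw [halves_inr_val, if_neg (by omega), Nat.add_sub_cancel_left, Pi.smul_apply, smul_eq_mul,
      mul_comm]

variable {A φ ψ}

/-- Nonsingularity means that no nontrivial pair of polynomials of degree at most `n`
annihilates `(φ, ψ)`. -/
theorem det_krylovMatrix_ne_zero_iff :
    (krylovMatrix A (n + 1) φ ψ).det ≠ 0 ↔
      ∀ f g : ℂ[X], f.natDegree ≤ n → g.natDegree ≤ n →
        revEval A n f *ᵥ φ + revEval A n g *ᵥ ψ = 0 → f = 0 ∧ g = 0 := by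
  have hz : (topPoly (0 : Fin (2 * n + 2) → ℂ)) = 0 ∧ botPoly (0 : Fin (2 * n + 2) → ℂ) = 0 := by
    simp [topPoly, botPoly]
  constructor
  · intro h f g hf hg h0
    obtain ⟨w, rfl, rfl⟩ := exists_topPoly_botPoly hf hg
    rw [← krylovMatrix_mulVec] at h0
    rw [Matrix.eq_zero_of_mulVec_eq_zero h h0]
    exact hz
  · intro h hdet
    obtain ⟨w, hw, h0⟩ := Matrix.exists_mulVec_eq_zero_iff.mpr hdet
    rw [krylovMatrix_mulVec] at h0
    obtain ⟨h1, h2⟩ := h _ _ (natDegree_topPoly_le w) (natDegree_botPoly_le w) h0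
    apply hw
    ext i
    obtain ⟨j | j, rfl⟩ := (halves n).surjective i
    · have := coeff_topPoly w j
      rw [h1] at this
      simpa using this.symm
    · have := coeff_botPoly w j
      rw [h2] at this
      simpa using this.symm

variable (A φ ψ)

/-- The solution `w` of `M w = -b`, `M` being the Krylov matrix, by Cramer's rule. -/
def krylovSolve (b : Fin (2 * n + 2) → ℂ) : Fin (2 * n + 2) → ℂ :=
  -((krylovMatrix A (n + 1) φ ψ).det⁻¹ • cramer (krylovMatrix A (n + 1) φ ψ) b)

/-- Upper left entry of the dressing matrix `G`, in powers of `λ⁻¹`: the matrix of polynomials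
with `G(A) (φ, ψ)ᵀ = 0` and `G = λ^(n+1) (1 + O(λ⁻¹))`. -/
def dressA : ℂ[X] := 1 + X * topPoly (krylovSolve A φ ψ (A ^ (n + 1) *ᵥ φ))

/-- Upper right entry of the dressing matrix. -/
def dressB : ℂ[X] := X * botPoly (krylovSolve A φ ψ (A ^ (n + 1) *ᵥ φ))

/-- Lower left entry of the dressing matrix. -/
def dressC : ℂ[X] := X * topPoly (krylovSolve A φ ψ (A ^ (n + 1) *ᵥ ψ))

/-- Lower right entry of the dressing matrix. -/
def dressD : ℂ[X] := 1 + X * botPoly (krylovSolve A φ ψ (A ^ (n + 1) *ᵥ ψ))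

theorem natDegree_X_mul_le {f : ℂ[X]} (hf : f.natDegree ≤ n) : (X * f).natDegree ≤ n + 1 :=
  (natDegree_mul_le).trans (by rw [natDegree_X]; omega)

theorem natDegree_one_add_X_mul_le {f : ℂ[X]} (hf : f.natDegree ≤ n) :
    (1 + X * f).natDegree ≤ n + 1 :=
  natDegree_add_le_of_degree_le (by simp) (natDegree_X_mul_le hf)

theorem natDegree_dressA_le : (dressA A φ ψ).natDegree ≤ n + 1 :=
  natDegree_one_add_X_mul_le (natDegree_topPoly_le _)

theorem natDegree_dressB_le : (dressB A φ ψ).natDegree ≤ n + 1 :=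
  natDegree_X_mul_le (natDegree_botPoly_le _)

theorem natDegree_dressC_le : (dressC A φ ψ).natDegree ≤ n + 1 :=
  natDegree_X_mul_le (natDegree_topPoly_le _)

theorem natDegree_dressD_le : (dressD A φ ψ).natDegree ≤ n + 1 :=
  natDegree_one_add_X_mul_le (natDegree_botPoly_le _)

variable {A φ ψ}

theorem krylovMatrix_mulVec_krylovSolve (h : (krylovMatrix A (n + 1) φ ψ).det ≠ 0)
    (b : Fin (2 * n + 2) → ℂ) :
    krylovMatrix A (n + 1) φ ψ *ᵥ krylovSolve A φ ψ b = -b := by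
  rw [krylovSolve, mulVec_neg, mulVec_smul, mulVec_cramer, smul_smul, inv_mul_cancel₀ h, one_smul]

theorem revEval_X_mul {d : ℕ} {f : ℂ[X]} (hf : f.natDegree ≤ d) :
    revEval A (d + 1) (X * f) = revEval A d f := by
  have := revEval_X_pow_mul A 1 hf
  rwa [pow_one, add_comm 1 d] at this

theorem revEval_dress_first (h : (krylovMatrix A (n + 1) φ ψ).det ≠ 0) :
    revEval A (n + 1) (dressA A φ ψ) *ᵥ φ + revEval A (n + 1) (dressB A φ ψ) *ᵥ ψ = 0 := by
  have := krylovMatrix_mulVec_krylovSolve h (A ^ (n + 1) *ᵥ φ)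
  rw [krylovMatrix_mulVec] at this
  rw [dressA, dressB, revEval_one_add_X_mul _ (natDegree_topPoly_le _),
    revEval_X_mul (natDegree_botPoly_le _), add_mulVec, add_assoc, this, add_neg_cancel]

theorem revEval_dress_second (h : (krylovMatrix A (n + 1) φ ψ).det ≠ 0) :
    revEval A (n + 1) (dressC A φ ψ) *ᵥ φ + revEval A (n + 1) (dressD A φ ψ) *ᵥ ψ = 0 := by
  have := krylovMatrix_mulVec_krylovSolve h (A ^ (n + 1) *ᵥ ψ)
  rw [krylovMatrix_mulVec] at this
  rw [dressC, dressD, revEval_one_add_X_mul _ (natDegree_botPoly_le _),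
    revEval_X_mul (natDegree_topPoly_le _), add_mulVec, add_left_comm, this, add_neg_cancel]

/-- Moving one column of a determinant. -/
theorem det_eq_of_move_col {N : ℕ} (P Q : Matrix (Fin (N + 1)) (Fin (N + 1)) ℂ)
    (c d : Fin (N + 1)) (hcol : ∀ i, P i c = Q i d)
    (hrest : ∀ i (j : Fin N), P i (c.succAbove j) = Q i (d.succAbove j)) :
    P.det = (-1) ^ ((c : ℕ) + d) * Q.det := by
  rw [det_succ_column P c, det_succ_column Q d, Finset.mul_sum]
  refine Finset.sum_congr rfl fun i _ => ?_
  have : P.submatrix i.succAbove c.succAbove = Q.submatrix i.succAbove d.succAbove := by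
    ext a b; exact hrest _ _
  rw [this, hcol, pow_add, pow_add, pow_add]
  have h1 : ((-1 : ℂ) ^ (d : ℕ)) * (-1) ^ (d : ℕ) = 1 := by rw [← mul_pow]; simp
  linear_combination -((-1) ^ (i : ℕ) * (-1) ^ (c : ℕ) * Q i d *
    (Q.submatrix i.succAbove d.succAbove).det) * h1

variable (A φ ψ)

/-- The coefficient is, up to sign, the last unknown of the Krylov system. Cramer's rule puts
A^(n+1) φ in the last column, and moving it behind A^n φ gives the matrix with n + 2 columns from φ.
-/
theorem coeff_one_dressB :
    (dressB A φ ψ).coeff 1 =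
      -((krylovMatrix A (n + 2) φ ψ).det / (krylovMatrix A (n + 1) φ ψ).det) := by
  have h := coeff_botPoly (krylovSolve A φ ψ (A ^ (n + 1) *ᵥ φ)) (Fin.last n)
  rw [Fin.val_last, Nat.sub_self] at h
  rw [dressB, coeff_X_mul, h, krylovSolve, Pi.neg_apply, Pi.smul_apply, cramer_apply]
  have hdet := det_eq_of_move_col (N := 2 * n + 1)
    ((krylovMatrix A (n + 1) φ ψ).updateCol (halves n (Sum.inr (Fin.last n)))
      (A ^ (n + 1) *ᵥ φ)) (krylovMatrix A (n + 2) φ ψ) (halves n (Sum.inr (Fin.last n)))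
      ⟨n + 1, by omega⟩ (fun i => by simp [krylovMatrix]) (fun i j => by
        have hl : halves n (Sum.inr (Fin.last n)) = Fin.last (2 * n + 1) := by
          ext; simp; omega
        rw [hl, updateCol_ne (Fin.succAbove_ne _ _), Fin.succAbove_last]
        simp only [krylovMatrix, Matrix.of_apply, Fin.val_castSucc]
        by_cases hj : (j : ℕ) < n + 1
        · rw [Fin.succAbove_of_castSucc_lt _ _ (by simpa [Fin.lt_def] using hj)]
          simp only [Fin.val_castSucc]
          rw [if_pos hj, if_pos (by omega)]
        · rw [Fin.succAbove_of_le_castSucc _ _ (by simpa [Fin.le_def] using hj)]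
          simp only [Fin.val_succ]
          rw [if_neg hj, if_neg (by omega), show (j : ℕ) + 1 - (n + 2) = j - (n + 1) by omega])
  rw [hdet, halves_inr_val, Fin.val_last, smul_eq_mul]
  -- The sign (-1)^n from `botPoly` cancels the sign of moving column 2n+1 to position n+1.
  have h1 : (-1 : ℂ) ^ n * (-1) ^ (n + 1 + n + (n + 1)) = 1 := by
    rw [← pow_add]; exact Even.neg_one_pow ⟨2 * n + 1, by ring⟩
  rw [div_eq_mul_inv]
  linear_combination -((krylovMatrix A (n + 1) φ ψ).det⁻¹ * (krylovMatrix A (n + 2) φ ψ).det) * h1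

theorem coeff_one_dressC :
    (dressC A φ ψ).coeff 1 =
      -((krylovMatrix A n φ ψ).det / (krylovMatrix A (n + 1) φ ψ).det) := by
  have h := coeff_topPoly (krylovSolve A φ ψ (A ^ (n + 1) *ᵥ ψ)) (Fin.last n)
  rw [Fin.val_last, Nat.sub_self] at h
  rw [dressC, coeff_X_mul, h, krylovSolve, Pi.neg_apply, Pi.smul_apply, cramer_apply]
  -- The columns of ψ are powers of -A. The sign produced here cancels the one from moving column n
  -- to the end.
  have hs : A ^ (n + 1) *ᵥ ψ = (-1 : ℂ) ^ (n + 1) • ((-A) ^ (n + 1) *ᵥ ψ) := by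
    rw [neg_pow A, ← smul_mulVec]
    congr 1
    rcases Nat.even_or_odd (n + 1) with h | h <;> simp [h.neg_one_pow]
  have hdet := det_eq_of_move_col (N := 2 * n + 1)
    ((krylovMatrix A (n + 1) φ ψ).updateCol (halves n (Sum.inl (Fin.last n)))
      ((-A) ^ (n + 1) *ᵥ ψ)) (krylovMatrix A n φ ψ) (halves n (Sum.inl (Fin.last n)))
      (Fin.last (2 * n + 1)) (fun i => by
        rw [updateCol_self]
        simp only [krylovMatrix, Matrix.of_apply, Fin.val_last]
        rw [if_neg (by omega)]
        congr 3; omega) (fun i j => by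
        rw [updateCol_ne (Fin.succAbove_ne _ _), Fin.succAbove_last]
        simp only [krylovMatrix, Matrix.of_apply, Fin.val_castSucc]
        by_cases hj : (j : ℕ) < n
        · rw [Fin.succAbove_of_castSucc_lt _ _ (by simpa [Fin.lt_def] using hj)]
          simp only [Fin.val_castSucc]
          rw [if_pos hj, if_pos (by omega)]
        · rw [Fin.succAbove_of_le_castSucc _ _ (by simpa [Fin.le_def] using hj)]
          simp only [Fin.val_succ]
          rw [if_neg hj, if_neg (by omega), show (j : ℕ) + 1 - (n + 1) = j - n by omega])
  rw [hs, det_updateCol_smul, hdet, halves_inl_val, Fin.val_last, smul_eq_mul, Fin.val_last]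
  have h1 : (-1 : ℂ) ^ (n + 1) * (-1) ^ (n + (2 * n + 1)) = 1 := by
    rw [← pow_add]; exact Even.neg_one_pow ⟨2 * n + 1, by ring⟩
  rw [div_eq_mul_inv]
  linear_combination -((krylovMatrix A (n + 1) φ ψ).det⁻¹ * (krylovMatrix A n φ ψ).det) * h1

end Dressing

/-! ### Coefficientwise differentiation of power series. -/

section CoeffDeriv

open PowerSeries

/-- `F'` is the coefficientwise derivative of `F` at `y`. -/
def HasCoeffDerivAt (F : ℝ → PowerSeries ℂ) (F' : PowerSeries ℂ) (y : ℝ) : Prop :=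
  ∀ j, HasDerivAt (fun z => coeff j (F z)) (coeff j F') y

variable {F G : ℝ → PowerSeries ℂ} {F' G' : PowerSeries ℂ} {y : ℝ}

theorem HasCoeffDerivAt.sub (hF : HasCoeffDerivAt F F' y) (hG : HasCoeffDerivAt G G' y) :
    HasCoeffDerivAt (fun z => F z - G z) (F' - G') y := fun j => by
  simpa only [map_sub] using (hF j).fun_sub (hG j)

theorem HasCoeffDerivAt.mul (hF : HasCoeffDerivAt F F' y) (hG : HasCoeffDerivAt G G' y) :
    HasCoeffDerivAt (fun z => F z * G z) (F' * G y + F y * G') y := fun j => by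
  simp only [coeff_mul, map_add, ← Finset.sum_add_distrib]
  exact HasDerivAt.fun_sum fun i _ => (hF i.1).mul (hG i.2)

theorem HasCoeffDerivAt.const_mul (c : PowerSeries ℂ) (hF : HasCoeffDerivAt F F' y) :
    HasCoeffDerivAt (fun z => c * F z) (c * F') y := by
  have h : HasCoeffDerivAt (fun _ => c) 0 y := fun j => by simpa using hasDerivAt_const y _
  simpa using h.mul hF

/-- Each coefficient of the inverse is a finite expression in the coefficients of F and earlier ones
of the inverse, so vanishing derivatives propagate. It is applied to det G. -/
theorem HasCoeffDerivAt.inv_of_zero (hF : HasCoeffDerivAt F 0 y)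
    (h0 : ∀ z, constantCoeff (F z) = 1) : HasCoeffDerivAt (fun z => (F z)⁻¹) 0 y := by
  intro j
  induction j using Nat.strong_induction_on with
  | _ j ih =>
    by_cases hj : j = 0
    · subst hj
      simp only [coeff_zero_eq_constantCoeff, constantCoeff_inv, h0, map_zero]
      exact hasDerivAt_const _ _
    · have hc : ∀ z, coeff j (F z)⁻¹ = -1⁻¹ * ∑ x ∈ Finset.HasAntidiagonal.antidiagonal j,
          if x.2 < j then coeff x.1 (F z) * coeff x.2 (F z)⁻¹ else 0 := fun z => by
        rw [coeff_inv, if_neg hj, h0]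
      simp only [hc, map_zero]
      have : HasDerivAt (fun z => ∑ x ∈ Finset.HasAntidiagonal.antidiagonal j,
          if x.2 < j then coeff x.1 (F z) * coeff x.2 (F z)⁻¹ else 0)
          (∑ x ∈ Finset.HasAntidiagonal.antidiagonal j, 0) y := by
        refine HasDerivAt.fun_sum fun x _ => ?_
        by_cases hx : x.2 < j
        · simp only [hx, if_true]
          exact ((hF x.1).fun_mul (ih _ hx)).congr_deriv (by simp)
        · simp only [hx, if_false]
          exact hasDerivAt_const _ _
      simpa using this.const_mul (-1⁻¹ : ℂ)

end CoeffDeriv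

/-! ### Evolution of a row of G under a linear flow of (φ, ψ). -/

section RowFlow

open Polynomial Matrix Filter Topology

variable {n : ℕ} {A : Matrix (Fin (2 * n + 2)) (Fin (2 * n + 2)) ℂ}

theorem hasDerivAt_mulVec {N : ℕ} (B : Matrix (Fin N) (Fin N) ℂ) {Φ : ℝ → Fin N → ℂ}
    {Φ' : Fin N → ℂ} {y : ℝ} (h : HasDerivAt Φ Φ' y) :
    HasDerivAt (fun z => B *ᵥ Φ z) (B *ᵥ Φ') y := by
  rw [hasDerivAt_pi] at h ⊢
  intro i
  simp only [mulVec, dotProduct]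
  exact HasDerivAt.fun_sum fun j _ => (h j).const_mul _

theorem hasDerivAt_revEval_mulVec {N d : ℕ} (A : Matrix (Fin N) (Fin N) ℂ) {f : ℝ → ℂ[X]}
    {f' : ℂ[X]} {Φ : ℝ → Fin N → ℂ} {Φ' : Fin N → ℂ} {y : ℝ}
    (hf : ∀ z, (f z).natDegree ≤ d) (hf' : f'.natDegree ≤ d)
    (hd : HasCoeffDerivAt (fun z => (f z : PowerSeries ℂ)) f' y) (h : HasDerivAt Φ Φ' y) :
    HasDerivAt (fun z => revEval A d (f z) *ᵥ Φ z)
      (revEval A d f' *ᵥ Φ y + revEval A d (f y) *ᵥ Φ') y := by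
  simp only [revEval_eq_sum A (hf _), revEval_eq_sum A hf', sum_mulVec, smul_mulVec,
    ← Finset.sum_add_distrib]
  refine HasDerivAt.fun_sum fun j _ => ?_
  have := (hd j).smul (hasDerivAt_mulVec (A ^ (d - j)) h)
  simp only [Polynomial.coeff_coe] at this
  rw [add_comm]
  exact this

theorem natDegree_three_term_le {m d : ℕ} {f f' v₁ v₂ g₁ g₂ : ℂ[X]} (κ : ℂ)
    (hf : f.natDegree ≤ d) (hf' : f'.natDegree ≤ d)
    (hv₁ : v₁.natDegree ≤ m) (hv₂ : v₂.natDegree ≤ m)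
    (hg₁ : g₁.natDegree ≤ d) (hg₂ : g₂.natDegree ≤ d) :
    (X ^ m * f' + C κ * (f - v₁ * g₁ - v₂ * g₂)).natDegree ≤ m + d := by
  refine natDegree_add_le_of_degree_le (natDegree_mul_le_of_le (natDegree_X_pow_le m) hf')
    ((natDegree_C_mul_le _ _).trans ?_)
  refine (natDegree_sub_le _ _).trans (max_le ((natDegree_sub_le _ _).trans (max_le (by omega) ?_))
    ?_)
  · exact natDegree_mul_le_of_le hv₁ hg₁
  · exact natDegree_mul_le_of_le hv₂ hg₂

/-- Low powers of λ⁻¹ are high powers of λ: divisibility by `X ^ (m + 1)` lowers the λ-degree of the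
reversed polynomial from m + d + 1 to d. -/
theorem exists_eq_X_pow_mul {m d : ℕ} {P : ℂ[X]} (hd : P.natDegree ≤ m + (d + 1))
    (h : X ^ (m + 1) ∣ P) : ∃ p : ℂ[X], p.natDegree ≤ d ∧ P = X ^ (m + 1) * p := by
  obtain ⟨p, rfl⟩ := h
  refine ⟨p, ?_, rfl⟩
  by_cases hp : p = 0
  · simp [hp]
  · rw [natDegree_mul (by simp) hp, natDegree_X_pow] at hd
    omega

theorem revEval_three_term {N m d : ℕ} (A : Matrix (Fin N) (Fin N) ℂ)
    {f f' v₁ v₂ g₁ g₂ : ℂ[X]} (κ : ℂ)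
    (hf : f.natDegree ≤ d) (hf' : f'.natDegree ≤ d)
    (hv₁ : v₁.natDegree ≤ m) (hv₂ : v₂.natDegree ≤ m)
    (hg₁ : g₁.natDegree ≤ d) (hg₂ : g₂.natDegree ≤ d) :
    revEval A (m + d) (X ^ m * f' + C κ * (f - v₁ * g₁ - v₂ * g₂)) =
      revEval A d f' + κ • (revEval A d f * A ^ m - revEval A m v₁ * revEval A d g₁ -
        revEval A m v₂ * revEval A d g₂) := by
  have h1 : revEval A (m + d) f = revEval A d f * A ^ m := by
    have := revEval_mul A (e := m) (g := 1) hf (by simp)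
    rwa [mul_one, revEval_one, add_comm d m] at this
  rw [revEval_add, revEval_X_pow_mul A m hf', revEval_C_mul, revEval_sub, revEval_sub, h1,
    revEval_mul A hv₁ hg₁, revEval_mul A hv₂ hg₂]

/-- Evolution of a row `(f, g)` annihilating `(Φ, Ψ)` under `Φ' = κ A^m Φ`, `Ψ' = -κ A^m Ψ`. -/
theorem row_flow {m : ℕ} {κ : ℂ} {y : ℝ} {Φ Ψ : ℝ → Fin (2 * n + 2) → ℂ}
    (hΦ : HasDerivAt Φ (κ • (A ^ m *ᵥ Φ y)) y) (hΨ : HasDerivAt Ψ (-(κ • (A ^ m *ᵥ Ψ y))) y)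
    (hdet : (krylovMatrix A (n + 1) (Φ y) (Ψ y)).det ≠ 0)
    {f g : ℝ → ℂ[X]} {f' g' : ℂ[X]}
    (hf : ∀ z, (f z).natDegree ≤ n + 1) (hg : ∀ z, (g z).natDegree ≤ n + 1)
    (hf' : f'.natDegree ≤ n + 1) (hg' : g'.natDegree ≤ n + 1) (hXf : X ∣ f') (hXg : X ∣ g')
    (hdf : HasCoeffDerivAt (fun z => (f z : PowerSeries ℂ)) f' y)
    (hdg : HasCoeffDerivAt (fun z => (g z : PowerSeries ℂ)) g' y)
    (hrel : ∀ᶠ z in 𝓝 y,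
      revEval A (n + 1) (f z) *ᵥ Φ z + revEval A (n + 1) (g z) *ᵥ Ψ z = 0)
    {v₁ v₂ : ℂ[X]} (hv₁ : v₁.natDegree ≤ m) (hv₂ : v₂.natDegree ≤ m)
    (h₁ : X ^ (m + 1) ∣ f y - v₁ * dressA A (Φ y) (Ψ y) - v₂ * dressC A (Φ y) (Ψ y))
    (h₂ : X ^ (m + 1) ∣ -g y - v₁ * dressB A (Φ y) (Ψ y) - v₂ * dressD A (Φ y) (Ψ y)) :
    X ^ m * f' + C κ * (f y - v₁ * dressA A (Φ y) (Ψ y) - v₂ * dressC A (Φ y) (Ψ y)) = 0 ∧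
    X ^ m * g' + C κ * (-g y - v₁ * dressB A (Φ y) (Ψ y) - v₂ * dressD A (Φ y) (Ψ y)) = 0 := by
  have hder := (hasDerivAt_revEval_mulVec A hf hf' hdf hΦ).add
    (hasDerivAt_revEval_mulVec A hg hg' hdg hΨ)
  -- The relation holds identically near y, so its derivative vanishes.
  have h0 := hder.unique ((hasDerivAt_const y 0).congr_of_eventuallyEq hrel)
  have hgn : (-g y).natDegree ≤ n + 1 := by rw [natDegree_neg]; exact hg y
  have hX : ∀ {p : ℂ[X]}, X ∣ p → X ^ (m + 1) ∣ X ^ m * p := fun h => by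
    rw [pow_succ]; exact mul_dvd_mul_left _ h
  obtain ⟨p, hp, hP⟩ := exists_eq_X_pow_mul
    (natDegree_three_term_le κ (hf y) hf' hv₁ hv₂ (natDegree_dressA_le A (Φ y) (Ψ y))
      (natDegree_dressC_le A (Φ y) (Ψ y)))
    (dvd_add (hX hXf) (h₁.mul_left (C κ)))
  obtain ⟨q, hq, hQ⟩ := exists_eq_X_pow_mul
    (natDegree_three_term_le κ hgn hg' hv₁ hv₂ (natDegree_dressB_le A (Φ y) (Ψ y))
      (natDegree_dressD_le A (Φ y) (Ψ y)))
    (dvd_add (hX hXg) (h₂.mul_left (C κ)))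
  have eP := revEval_three_term A κ (hf y) hf' hv₁ hv₂ (natDegree_dressA_le A (Φ y) (Ψ y))
      (natDegree_dressC_le A (Φ y) (Ψ y))
  have eQ := revEval_three_term A κ hgn hg' hv₁ hv₂ (natDegree_dressB_le A (Φ y) (Ψ y))
      (natDegree_dressD_le A (Φ y) (Ψ y))
  rw [hP, show m + (n + 1) = m + 1 + n by ring, revEval_X_pow_mul A _ hp] at eP
  rw [hQ, show m + (n + 1) = m + 1 + n by ring, revEval_X_pow_mul A _ hq] at eQ
  -- The quotients p, q annihilate (Φ, Ψ): their values at A come from the differentiated relation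
  -- minus multiples of the two rows of G(A). Having degree at most n, they vanish by
  -- nonsingularity.
  have hz : revEval A n p *ᵥ Φ y + revEval A n q *ᵥ Ψ y = 0 := by
    have r1 := congrArg (fun v => revEval A m v₁ *ᵥ v) (revEval_dress_first hdet)
    have r2 := congrArg (fun v => revEval A m v₂ *ᵥ v) (revEval_dress_second hdet)
    simp only [mulVec_add, mulVec_mulVec, mulVec_zero] at r1 r2
    simp only [mulVec_neg, mulVec_smul, mulVec_mulVec] at h0
    rw [eP, eQ]
    simp only [add_mulVec, smul_mulVec, sub_mulVec, revEval_neg, neg_mul, neg_mulVec]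
    have r1' := congrArg (κ • ·) r1
    have r2' := congrArg (κ • ·) r2
    simp only [smul_add, smul_sub, smul_neg, smul_zero] at r1' r2' ⊢
    linear_combination h0 - r1' - r2'
  obtain ⟨rfl, rfl⟩ := det_krylovMatrix_ne_zero_iff.mp hdet p q hp hq hz
  exact ⟨by rw [hP, mul_zero], by rw [hQ, mul_zero]⟩

end RowFlow

/-! ### Smoothness of determinants and differentiability of the dressing coefficients. -/

section Differentiability

open Polynomial Matrix Filter Topology

variable {n : ℕ} {A : Matrix (Fin (2 * n + 2)) (Fin (2 * n + 2)) ℂ}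

theorem contDiffAt_det {E : Type*} [NormedAddCommGroup E] [NormedSpace ℝ E] {N : ℕ}
    {k : WithTop ℕ∞} {M : E → Matrix (Fin N) (Fin N) ℂ} {x : E}
    (h : ∀ i j, ContDiffAt ℝ k (fun e => M e i j) x) : ContDiffAt ℝ k (fun e => (M e).det) x := by
  simp only [det_apply']
  refine ContDiffAt.sum fun σ _ => ?_
  refine contDiffAt_const.mul ?_
  exact contDiffAt_prod fun i _ => h _ _

theorem differentiableAt_det {N : ℕ} {M : ℝ → Matrix (Fin N) (Fin N) ℂ} {y : ℝ}
    (h : ∀ i j, DifferentiableAt ℝ (fun z => M z i j) y) :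
    DifferentiableAt ℝ (fun z => (M z).det) y := by
  simp only [det_apply']
  refine DifferentiableAt.fun_sum fun σ _ => ?_
  refine (differentiableAt_const _).mul ?_
  exact DifferentiableAt.fun_finsetProd fun i _ => h _ _

theorem differentiableAt_krylovMatrix {N : ℕ} (A : Matrix (Fin N) (Fin N) ℂ) (p : ℕ)
    {Φ Ψ : ℝ → Fin N → ℂ} {y : ℝ}
    (hΦ : DifferentiableAt ℝ Φ y) (hΨ : DifferentiableAt ℝ Ψ y) (i j : Fin N) :
    DifferentiableAt ℝ (fun z => krylovMatrix A p (Φ z) (Ψ z) i j) y := by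
  simp only [krylovMatrix, Matrix.of_apply]
  split_ifs
  · exact (hasDerivAt_pi.mp (hasDerivAt_mulVec _ hΦ.hasDerivAt) i).differentiableAt
  · exact (hasDerivAt_pi.mp (hasDerivAt_mulVec _ hΨ.hasDerivAt) i).differentiableAt

theorem differentiableAt_krylovSolve {Φ Ψ b : ℝ → Fin (2 * n + 2) → ℂ} {y : ℝ}
    (hΦ : DifferentiableAt ℝ Φ y) (hΨ : DifferentiableAt ℝ Ψ y) (hb : DifferentiableAt ℝ b y)
    (hdet : (krylovMatrix A (n + 1) (Φ y) (Ψ y)).det ≠ 0) :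
    DifferentiableAt ℝ (fun z => krylovSolve A (Φ z) (Ψ z) (b z)) y := by
  rw [differentiableAt_pi]
  intro i
  simp only [krylovSolve, Pi.neg_apply, Pi.smul_apply, cramer_apply, smul_eq_mul]
  have hM := differentiableAt_krylovMatrix A (n + 1) hΦ hΨ
  refine (((differentiableAt_det hM).inv hdet).mul (differentiableAt_det fun k l => ?_)).neg
  simp only [updateCol_apply]
  split_ifs
  · exact differentiableAt_pi.mp hb k
  · exact hM k l

theorem eventually_det_krylovMatrix_ne_zero {Φ Ψ : ℝ → Fin (2 * n + 2) → ℂ} {y : ℝ}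
    (hΦ : DifferentiableAt ℝ Φ y) (hΨ : DifferentiableAt ℝ Ψ y)
    (hdet : (krylovMatrix A (n + 1) (Φ y) (Ψ y)).det ≠ 0) :
    ∀ᶠ z in 𝓝 y, (krylovMatrix A (n + 1) (Φ z) (Ψ z)).det ≠ 0 :=
  (differentiableAt_det (differentiableAt_krylovMatrix A (n + 1) hΦ hΨ)).continuousAt.eventually_ne
    hdet

theorem hasCoeffDerivAt_topPoly {w : ℝ → Fin (2 * n + 2) → ℂ} {w' : Fin (2 * n + 2) → ℂ} {y : ℝ}
    (h : HasDerivAt w w' y) :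
    HasCoeffDerivAt (fun z => (topPoly (w z) : PowerSeries ℂ)) (topPoly w') y := by
  intro j
  simp only [Polynomial.coeff_coe, topPoly, finsetSum_coeff, coeff_monomial]
  refine HasDerivAt.fun_sum fun i _ => ?_
  split_ifs
  · exact hasDerivAt_pi.mp h _
  · exact hasDerivAt_const _ _

theorem hasCoeffDerivAt_botPoly {w : ℝ → Fin (2 * n + 2) → ℂ} {w' : Fin (2 * n + 2) → ℂ} {y : ℝ}
    (h : HasDerivAt w w' y) :
    HasCoeffDerivAt (fun z => (botPoly (w z) : PowerSeries ℂ)) (botPoly w') y := by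
  intro j
  simp only [Polynomial.coeff_coe, botPoly, finsetSum_coeff, coeff_monomial]
  refine HasDerivAt.fun_sum fun i _ => ?_
  split_ifs
  · exact (hasDerivAt_pi.mp h _).const_mul _
  · exact hasDerivAt_const _ _

theorem hasCoeffDerivAt_X_mul {f : ℝ → ℂ[X]} {f' : ℂ[X]} {y : ℝ}
    (h : HasCoeffDerivAt (fun z => (f z : PowerSeries ℂ)) f' y) :
    HasCoeffDerivAt (fun z => ((X * f z : ℂ[X]) : PowerSeries ℂ)) ((X * f' : ℂ[X])) y := by
  simpa using h.const_mul PowerSeries.X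

theorem hasCoeffDerivAt_one_add_X_mul {f : ℝ → ℂ[X]} {f' : ℂ[X]} {y : ℝ}
    (h : HasCoeffDerivAt (fun z => (f z : PowerSeries ℂ)) f' y) :
    HasCoeffDerivAt (fun z => ((1 + X * f z : ℂ[X]) : PowerSeries ℂ)) ((X * f' : ℂ[X])) y := by
  intro j
  have := (hasCoeffDerivAt_X_mul h j).const_add (PowerSeries.coeff j 1)
  simpa only [Polynomial.coe_add, map_add, Polynomial.coe_one] using this

end Differentiability

/-! ### The series S = G σ G⁻¹ and its Lax equation. -/

section LaxSeries

open Polynomial Matrix Filter Topology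

variable {n : ℕ} (A : Matrix (Fin (2 * n + 2)) (Fin (2 * n + 2)) ℂ) (φ ψ : Fin (2 * n + 2) → ℂ)

/-- The determinant of the dressing matrix `G`. -/
def dressDet : PowerSeries ℂ :=
  (dressA A φ ψ : PowerSeries ℂ) * (dressD A φ ψ : PowerSeries ℂ) -
    (dressB A φ ψ : PowerSeries ℂ) * (dressC A φ ψ : PowerSeries ℂ)

/-- Upper left entry of `S = G σ G⁻¹`, where `σ = diag(1, -1)`. -/
def conjA : PowerSeries ℂ :=
  ((dressA A φ ψ : PowerSeries ℂ) * (dressD A φ ψ : PowerSeries ℂ) +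
    (dressB A φ ψ : PowerSeries ℂ) * (dressC A φ ψ : PowerSeries ℂ)) * (dressDet A φ ψ)⁻¹

/-- Upper right entry of `S = G σ G⁻¹`. -/
def conjB : PowerSeries ℂ :=
  -2 * ((dressA A φ ψ : PowerSeries ℂ) * (dressB A φ ψ : PowerSeries ℂ)) * (dressDet A φ ψ)⁻¹

/-- Lower left entry of `S = G σ G⁻¹`. -/
def conjC : PowerSeries ℂ :=
  2 * ((dressC A φ ψ : PowerSeries ℂ) * (dressD A φ ψ : PowerSeries ℂ)) * (dressDet A φ ψ)⁻¹

theorem coeff_zero_dressA : (dressA A φ ψ).coeff 0 = 1 := by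
  simp [dressA]

theorem coeff_zero_dressB : (dressB A φ ψ).coeff 0 = 0 := by
  simp [dressB]

theorem coeff_zero_dressC : (dressC A φ ψ).coeff 0 = 0 := by
  simp [dressC]

theorem coeff_zero_dressD : (dressD A φ ψ).coeff 0 = 1 := by
  simp [dressD]

/-- No nonsingularity is needed: the constant terms of G are those of the identity whatever
`krylovSolve` returns, so det G is invertible everywhere. -/
theorem constantCoeff_dressDet : PowerSeries.constantCoeff (dressDet A φ ψ) = 1 := by
  simp [dressDet, coeff_zero_dressA, coeff_zero_dressB, coeff_zero_dressD]

theorem dressDet_mul_inv : dressDet A φ ψ * (dressDet A φ ψ)⁻¹ = 1 :=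
  PowerSeries.mul_inv_cancel _ (by simp [constantCoeff_dressDet])

theorem constantCoeff_conjA : PowerSeries.constantCoeff (conjA A φ ψ) = 1 := by
  simp [conjA, coeff_zero_dressA, coeff_zero_dressB, coeff_zero_dressD,
    constantCoeff_dressDet]

theorem constantCoeff_conjB : PowerSeries.constantCoeff (conjB A φ ψ) = 0 := by
  simp [conjB, coeff_zero_dressB]

theorem constantCoeff_conjC : PowerSeries.constantCoeff (conjC A φ ψ) = 0 := by
  simp [conjC, coeff_zero_dressC]

theorem conj_sq : conjA A φ ψ * conjA A φ ψ + conjB A φ ψ * conjC A φ ψ = 1 := by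
  have h := dressDet_mul_inv A φ ψ
  have h2 : dressDet A φ ψ * (dressDet A φ ψ)⁻¹ * (dressDet A φ ψ * (dressDet A φ ψ)⁻¹) = 1 := by
    rw [h, one_mul]
  simp only [conjA, conjB, conjC]
  generalize (dressDet A φ ψ)⁻¹ = e at *
  simp only [dressDet] at h2
  linear_combination h2

/-- This and the next lemma are the first row of S G = G σ. -/
theorem conj_mul_first_left :
    conjA A φ ψ * (dressA A φ ψ : PowerSeries ℂ) + conjB A φ ψ * (dressC A φ ψ : PowerSeries ℂ) =
      (dressA A φ ψ : PowerSeries ℂ) := by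
  have h := dressDet_mul_inv A φ ψ
  simp only [conjA, conjB]
  generalize (dressDet A φ ψ)⁻¹ = e at *
  simp only [dressDet] at h
  linear_combination (dressA A φ ψ : PowerSeries ℂ) * h

theorem conj_mul_first_right :
    conjA A φ ψ * (dressB A φ ψ : PowerSeries ℂ) + conjB A φ ψ * (dressD A φ ψ : PowerSeries ℂ) =
      -(dressB A φ ψ : PowerSeries ℂ) := by
  have h := dressDet_mul_inv A φ ψ
  simp only [conjA, conjB]
  generalize (dressDet A φ ψ)⁻¹ = e at *
  simp only [dressDet] at h
  linear_combination -(dressB A φ ψ : PowerSeries ℂ) * h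

theorem X_pow_dvd_of_coe {k : ℕ} {p : ℂ[X]}
    (h : (PowerSeries.X : PowerSeries ℂ) ^ k ∣ (p : PowerSeries ℂ)) : X ^ k ∣ p := by
  rw [PowerSeries.X_pow_dvd_iff] at h
  rw [Polynomial.X_pow_dvd_iff]
  intro d hd
  simpa using h d hd

/-- The reversed truncation is the polynomial part of λ^m f. The leading coefficient of the
remainder is what drives the flow. -/
theorem exists_sub_trunc (m : ℕ) (f : PowerSeries ℂ) : ∃ t : PowerSeries ℂ,
    f - ((PowerSeries.trunc (m + 1) f : ℂ[X]) : PowerSeries ℂ) = PowerSeries.X ^ (m + 1) * t ∧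
      PowerSeries.constantCoeff t = PowerSeries.coeff (m + 1) f := by
  have h := PowerSeries.eq_X_pow_mul_shift_add_trunc (m + 1) f
  refine ⟨_, sub_eq_iff_eq_add.mpr h, ?_⟩
  rw [← PowerSeries.coeff_zero_eq_constantCoeff_apply, PowerSeries.coeff_mk]
  simp

variable {A}
variable {m : ℕ} {κ : ℂ} {y : ℝ} {Φ Ψ : ℝ → Fin (2 * n + 2) → ℂ}

/-- Under the flow `Φ' = κ A^m Φ`, `Ψ' = -κ A^m Ψ` the leading coefficient of the upper right
entry of `G` moves by the coefficient `m + 1` of the upper right entry of `S`. -/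
theorem hasDerivAt_coeff_one_dressB
    (hΦ : HasDerivAt Φ (κ • (A ^ m *ᵥ Φ y)) y) (hΨ : HasDerivAt Ψ (-(κ • (A ^ m *ᵥ Ψ y))) y)
    (hdet : (krylovMatrix A (n + 1) (Φ y) (Ψ y)).det ≠ 0) :
    HasDerivAt (fun z => (dressB A (Φ z) (Ψ z)).coeff 1)
      (-(κ * PowerSeries.coeff (m + 1) (conjB A (Φ y) (Ψ y)))) y := by
  have hw := (differentiableAt_krylovSolve hΦ.differentiableAt hΨ.differentiableAt
    (hasDerivAt_mulVec (A ^ (n + 1)) hΦ).differentiableAt hdet).hasDerivAt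
  have hA := hasCoeffDerivAt_one_add_X_mul (hasCoeffDerivAt_topPoly hw)
  have hB := hasCoeffDerivAt_X_mul (hasCoeffDerivAt_botPoly hw)
  obtain ⟨s, hs, hs0⟩ := exists_sub_trunc m (conjA A (Φ y) (Ψ y))
  obtain ⟨t, ht, ht0⟩ := exists_sub_trunc m (conjB A (Φ y) (Ψ y))
  have e₁ := conj_mul_first_left A (Φ y) (Ψ y)
  have e₂ := conj_mul_first_right A (Φ y) (Ψ y)
  have e₂' : (-(dressB A (Φ y) (Ψ y) : PowerSeries ℂ) -
      ((PowerSeries.trunc (m + 1) (conjA A (Φ y) (Ψ y)) : ℂ[X]) : PowerSeries ℂ) *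
        (dressB A (Φ y) (Ψ y) : PowerSeries ℂ) -
      ((PowerSeries.trunc (m + 1) (conjB A (Φ y) (Ψ y)) : ℂ[X]) : PowerSeries ℂ) *
        dressD A (Φ y) (Ψ y) :
        PowerSeries ℂ) = PowerSeries.X ^ (m + 1) * (s * (dressB A (Φ y) (Ψ y) : PowerSeries ℂ) +
          t * (dressD A (Φ y) (Ψ y) : PowerSeries ℂ)) := by
    linear_combination (dressB A (Φ y) (Ψ y) : PowerSeries ℂ) * hs +
      (dressD A (Φ y) (Ψ y) : PowerSeries ℂ) * ht - e₂
  have key := (row_flow hΦ hΨ hdet (fun z => natDegree_dressA_le A (Φ z) (Ψ z))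
    (fun z => natDegree_dressB_le A (Φ z) (Ψ z))
    (natDegree_X_mul_le (natDegree_topPoly_le _)) (natDegree_X_mul_le (natDegree_botPoly_le _))
    (dvd_mul_right _ _) (dvd_mul_right _ _) hA hB
    ((eventually_det_krylovMatrix_ne_zero hΦ.differentiableAt hΨ.differentiableAt hdet).mono
      fun z hz => revEval_dress_first hz)
    (Nat.lt_succ_iff.mp (PowerSeries.natDegree_trunc_lt (conjA A (Φ y) (Ψ y)) m))
    (Nat.lt_succ_iff.mp (PowerSeries.natDegree_trunc_lt (conjB A (Φ y) (Ψ y)) m))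
    (X_pow_dvd_of_coe ⟨s * (dressA A (Φ y) (Ψ y) : PowerSeries ℂ) +
      t * (dressC A (Φ y) (Ψ y) : PowerSeries ℂ), by
      push_cast
      linear_combination (dressA A (Φ y) (Ψ y) : PowerSeries ℂ) * hs +
        (dressC A (Φ y) (Ψ y) : PowerSeries ℂ) * ht - e₁⟩)
    (X_pow_dvd_of_coe ⟨_, by push_cast; exact e₂'⟩)).2
  -- In degree m + 1 only the constant terms of the remainders s, t and of G survive, and these are
  -- 0 for `dressB` and 1 for `dressD`.
  have hc := congrArg (fun p : ℂ[X] => PowerSeries.coeff (m + 1) (p : PowerSeries ℂ)) key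
  simp only [Polynomial.coe_add, Polynomial.coe_mul, Polynomial.coe_sub, Polynomial.coe_neg,
    Polynomial.coe_pow, Polynomial.coe_X, Polynomial.coe_C, map_add, PowerSeries.coeff_C_mul,
    Polynomial.coe_zero, map_zero, e₂', PowerSeries.coeff_X_pow_mul'] at hc
  have h1 := hB 1
  simp only [Polynomial.coe_mul, Polynomial.coe_X, add_tsub_cancel_left, Nat.sub_self,
    le_add_iff_nonneg_right, zero_le, le_refl, if_true, map_mul,
    PowerSeries.coeff_zero_eq_constantCoeff, Polynomial.constantCoeff_coe, coeff_zero_dressB,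
    coeff_zero_dressD, ht0, mul_zero, mul_one, zero_add] at hc h1
  rw [eq_neg_of_add_eq_zero_left hc] at h1
  refine h1.congr_of_eventuallyEq (Eventually.of_forall fun z => ?_)
  simp [dressB]

/-- The `x`-evolution of the dressing matrix: the case `m = 1` of the flows. -/
theorem exists_hasCoeffDerivAt_dress
    (hΦ : HasDerivAt Φ (A *ᵥ Φ y) y) (hΨ : HasDerivAt Ψ (-(A *ᵥ Ψ y)) y)
    (hdet : (krylovMatrix A (n + 1) (Φ y) (Ψ y)).det ≠ 0) {q r : ℂ}
    (hq : q = -2 * (dressB A (Φ y) (Ψ y)).coeff 1) (hr : r = 2 * (dressC A (Φ y) (Ψ y)).coeff 1) :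
    ∃ α β γ δ : PowerSeries ℂ,
      HasCoeffDerivAt (fun z => (dressA A (Φ z) (Ψ z) : PowerSeries ℂ)) α y ∧
      HasCoeffDerivAt (fun z => (dressB A (Φ z) (Ψ z) : PowerSeries ℂ)) β y ∧
      HasCoeffDerivAt (fun z => (dressC A (Φ z) (Ψ z) : PowerSeries ℂ)) γ y ∧
      HasCoeffDerivAt (fun z => (dressD A (Φ z) (Ψ z) : PowerSeries ℂ)) δ y ∧
      PowerSeries.X * α = PowerSeries.X * PowerSeries.C q * (dressC A (Φ y) (Ψ y) : PowerSeries ℂ) ∧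
      PowerSeries.X * β = 2 * (dressB A (Φ y) (Ψ y) : PowerSeries ℂ) +
        PowerSeries.X * PowerSeries.C q * (dressD A (Φ y) (Ψ y) : PowerSeries ℂ) ∧
      PowerSeries.X * γ = -2 * (dressC A (Φ y) (Ψ y) : PowerSeries ℂ) +
        PowerSeries.X * PowerSeries.C r * (dressA A (Φ y) (Ψ y) : PowerSeries ℂ) ∧
      PowerSeries.X * δ = PowerSeries.X * PowerSeries.C r * (dressB A (Φ y) (Ψ y) : PowerSeries ℂ) := by
  have hΦ' : HasDerivAt Φ ((1 : ℂ) • (A ^ 1 *ᵥ Φ y)) y := by simpa using hΦ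
  have hΨ' : HasDerivAt Ψ (-((1 : ℂ) • (A ^ 1 *ᵥ Ψ y))) y := by simpa using hΨ
  have hw₁ := (differentiableAt_krylovSolve hΦ.differentiableAt hΨ.differentiableAt
    (hasDerivAt_mulVec (A ^ (n + 1)) hΦ).differentiableAt hdet).hasDerivAt
  have hw₂ := (differentiableAt_krylovSolve hΦ.differentiableAt hΨ.differentiableAt
    (hasDerivAt_mulVec (A ^ (n + 1)) hΨ).differentiableAt hdet).hasDerivAt
  have hA := hasCoeffDerivAt_one_add_X_mul (hasCoeffDerivAt_topPoly hw₁)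
  have hB := hasCoeffDerivAt_X_mul (hasCoeffDerivAt_botPoly hw₁)
  have hC := hasCoeffDerivAt_X_mul (hasCoeffDerivAt_topPoly hw₂)
  have hD := hasCoeffDerivAt_one_add_X_mul (hasCoeffDerivAt_botPoly hw₂)
  have hev := eventually_det_krylovMatrix_ne_zero hΦ.differentiableAt hΨ.differentiableAt hdet
  have hlin : ∀ c : ℂ, (C c * X : ℂ[X]).natDegree ≤ 1 := fun c =>
    natDegree_C_mul_le c X |>.trans natDegree_X_le
  have a0 : (dressA A (Φ y) (Ψ y)).coeff 0 = 1 := by simp [dressA]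
  have b0 : (dressB A (Φ y) (Ψ y)).coeff 0 = 0 := by simp [dressB]
  have c0 : (dressC A (Φ y) (Ψ y)).coeff 0 = 0 := by simp [dressC]
  have d0 : (dressD A (Φ y) (Ψ y)).coeff 0 = 1 := by simp [dressD]
  have dvd : ∀ {p : ℂ[X]}, p.coeff 0 = 0 → p.coeff 1 = 0 → X ^ (1 + 1) ∣ p := fun h0 h1 => by
    rw [Polynomial.X_pow_dvd_iff]
    intro d hd
    interval_cases d <;> assumption
  have hcX : ∀ (c : ℂ) (p : ℂ[X]), (C c * X * p).coeff 0 = 0 ∧ (C c * X * p).coeff 1 =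
      c * p.coeff 0 := fun c p => by
    rw [mul_assoc]; constructor
    · simp
    · rw [coeff_C_mul, coeff_X_mul]
  -- The multipliers 1 and q λ⁻¹ are the first row of λσ + U divided by λ. The definition of q is
  -- exactly the required divisibility by λ⁻².
  have k₁ := row_flow hΦ' hΨ' hdet (fun z => natDegree_dressA_le A (Φ z) (Ψ z))
    (fun z => natDegree_dressB_le A (Φ z) (Ψ z))
    (natDegree_X_mul_le (natDegree_topPoly_le _)) (natDegree_X_mul_le (natDegree_botPoly_le _))
    (dvd_mul_right _ _) (dvd_mul_right _ _) hA hB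
    (hev.mono fun z hz => revEval_dress_first hz) (v₁ := 1) (by simp) (hlin q)
    (dvd (by simp [(hcX _ _).1]) (by simp [(hcX _ _).2, c0]))
    (dvd (by simp [(hcX _ _).1, b0]) (by
      rw [coeff_sub, coeff_sub, coeff_neg, (hcX _ _).2, d0, hq, one_mul]; ring))
  have k₂ := row_flow hΦ' hΨ' hdet (fun z => natDegree_dressC_le A (Φ z) (Ψ z))
    (fun z => natDegree_dressD_le A (Φ z) (Ψ z))
    (natDegree_X_mul_le (natDegree_topPoly_le _)) (natDegree_X_mul_le (natDegree_botPoly_le _))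
    (dvd_mul_right _ _) (dvd_mul_right _ _) hC hD
    (hev.mono fun z hz => revEval_dress_second hz) (v₂ := -1) (hlin r) (by simp)
    (dvd (by simp [(hcX _ _).1, c0]) (by
      rw [coeff_sub, coeff_sub, (hcX _ _).2, a0, hr, neg_one_mul, coeff_neg]; ring))
    (dvd (by simp [(hcX _ _).1]) (by simp [(hcX _ _).2, b0]))
  refine ⟨_, _, _, _, hA, hB, hC, hD, ?_, ?_, ?_, ?_⟩
  · have := congrArg (fun p : ℂ[X] => (p : PowerSeries ℂ)) k₁.1
    push_cast at this
    simp only [pow_one, map_one] at this ⊢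
    push_cast
    linear_combination this
  · have := congrArg (fun p : ℂ[X] => (p : PowerSeries ℂ)) k₁.2
    push_cast at this
    simp only [pow_one, map_one] at this ⊢
    push_cast
    linear_combination this
  · have := congrArg (fun p : ℂ[X] => (p : PowerSeries ℂ)) k₂.1
    push_cast at this
    simp only [pow_one, map_one] at this ⊢
    push_cast
    linear_combination this
  · have := congrArg (fun p : ℂ[X] => (p : PowerSeries ℂ)) k₂.2
    push_cast at this
    simp only [pow_one, map_one] at this ⊢
    push_cast
    linear_combination this

/-- The Lax equation `S_x = [λσ + U, S]` for the off-diagonal entries, coefficientwise. -/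
theorem hasDerivAt_coeff_conj
    (hΦ : HasDerivAt Φ (A *ᵥ Φ y) y) (hΨ : HasDerivAt Ψ (-(A *ᵥ Ψ y)) y)
    (hdet : (krylovMatrix A (n + 1) (Φ y) (Ψ y)).det ≠ 0) {q r : ℂ}
    (hq : q = -2 * (dressB A (Φ y) (Ψ y)).coeff 1) (hr : r = 2 * (dressC A (Φ y) (Ψ y)).coeff 1)
    (j : ℕ) :
    HasDerivAt (fun z => PowerSeries.coeff j (conjB A (Φ z) (Ψ z)))
      (2 * PowerSeries.coeff (j + 1) (conjB A (Φ y) (Ψ y)) -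
        2 * q * PowerSeries.coeff j (conjA A (Φ y) (Ψ y))) y ∧
    HasDerivAt (fun z => PowerSeries.coeff j (conjC A (Φ z) (Ψ z)))
      (-2 * PowerSeries.coeff (j + 1) (conjC A (Φ y) (Ψ y)) +
        2 * r * PowerSeries.coeff j (conjA A (Φ y) (Ψ y))) y := by
  obtain ⟨α, β, γ, δ, hα, hβ, hγ, hδ, eα, eβ, eγ, eδ⟩ :=
    exists_hasCoeffDerivAt_dress hΦ hΨ hdet hq hr
  have hXne : (PowerSeries.X : PowerSeries ℂ) ≠ 0 := PowerSeries.X_ne_zero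
  have hd := (hα.mul hδ).sub (hβ.mul hγ)
  -- det G is constant in x because λσ + U and λσ are traceless. Hence only the numerators of S need
  -- differentiating.
  have hd0 : α * (dressD A (Φ y) (Ψ y) : PowerSeries ℂ) + (dressA A (Φ y) (Ψ y) : PowerSeries ℂ) * δ -
      (β * (dressC A (Φ y) (Ψ y) : PowerSeries ℂ) + (dressB A (Φ y) (Ψ y) : PowerSeries ℂ) * γ) = 0 := by
    refine mul_left_cancel₀ hXne ?_
    linear_combination (dressD A (Φ y) (Ψ y) : PowerSeries ℂ) * eα +
      (dressA A (Φ y) (Ψ y) : PowerSeries ℂ) * eδ - (dressC A (Φ y) (Ψ y) : PowerSeries ℂ) * eβ -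
      (dressB A (Φ y) (Ψ y) : PowerSeries ℂ) * eγ
  rw [hd0] at hd
  have he := HasCoeffDerivAt.inv_of_zero (F := fun z => dressDet A (Φ z) (Ψ z)) hd
    (fun z => constantCoeff_dressDet A (Φ z) (Ψ z))
  have hb := ((hα.mul hβ).const_mul (-2)).mul he
  have hc := ((hγ.mul hδ).const_mul 2).mul he
  simp only [mul_zero, add_zero] at hb hc
  have two_coeff : ∀ (i : ℕ) (f : PowerSeries ℂ), PowerSeries.coeff i (2 * f) =
      2 * PowerSeries.coeff i f := fun i f => by rw [two_mul, map_add, two_mul]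
  constructor
  · refine (hb j).congr_deriv ?_
    rw [← PowerSeries.coeff_succ_X_mul]
    trans PowerSeries.coeff (j + 1) (2 * conjB A (Φ y) (Ψ y) -
      PowerSeries.X * (PowerSeries.C q * (2 * conjA A (Φ y) (Ψ y))))
    · congr 1
      simp only [conjA, conjB]
      linear_combination -2 * (dressDet A (Φ y) (Ψ y))⁻¹ *
        ((dressB A (Φ y) (Ψ y) : PowerSeries ℂ) * eα +
          (dressA A (Φ y) (Ψ y) : PowerSeries ℂ) * eβ)
    · rw [map_sub, PowerSeries.coeff_succ_X_mul, PowerSeries.coeff_C_mul, two_coeff, two_coeff]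
      ring
  · refine (hc j).congr_deriv ?_
    rw [← PowerSeries.coeff_succ_X_mul]
    trans PowerSeries.coeff (j + 1) (-(2 * conjC A (Φ y) (Ψ y)) +
      PowerSeries.X * (PowerSeries.C r * (2 * conjA A (Φ y) (Ψ y))))
    · congr 1
      simp only [conjA, conjC]
      linear_combination 2 * (dressDet A (Φ y) (Ψ y))⁻¹ *
        ((dressD A (Φ y) (Ψ y) : PowerSeries ℂ) * eγ +
          (dressC A (Φ y) (Ψ y) : PowerSeries ℂ) * eδ)
    · rw [map_add, map_neg, PowerSeries.coeff_succ_X_mul, PowerSeries.coeff_C_mul, two_coeff,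
        two_coeff]
      ring

end LaxSeries

/-! ### Identifying S with the universal differential polynomials. -/

section Identification

open Filter Topology

theorem contDiffAt_iteratedDeriv {f : ℝ → ℂ} {x : ℝ} (h : ContDiffAt ℝ ∞ f x) (j : ℕ) :
    ContDiffAt ℝ ∞ (iteratedDeriv j f) x := by
  induction j with
  | zero => simpa using h
  | succ j ih =>
    rw [iteratedDeriv_succ]
    exact (ih.fderiv_right (m := ∞) (by simp)).clm_apply contDiffAt_const

theorem hasDerivAt_iteratedDeriv {f : ℝ → ℂ} {x : ℝ} (h : ContDiffAt ℝ ∞ f x) (j : ℕ) :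
    HasDerivAt (iteratedDeriv j f) (iteratedDeriv (j + 1) f x) x := by
  rw [iteratedDeriv_succ]
  exact ((contDiffAt_iteratedDeriv h j).differentiableAt (by simp)).hasDerivAt

/-- The total derivative computes the derivative of the value of a differential polynomial. -/
theorem hasDerivAt_evalAt (p : DiffPoly) {q r : ℝ → ℂ} {x : ℝ}
    (hq : ContDiffAt ℝ ∞ q x) (hr : ContDiffAt ℝ ∞ r x) :
    HasDerivAt (evalAt p q r) (evalAt (dx p) q r x) x := by
  unfold evalAt
  induction p using MvPolynomial.induction_on with
  | C a => simpa [dx] using hasDerivAt_const x a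
  | add p p' h h' => simpa only [map_add] using h.fun_add h'
  | mul_X p i h =>
    simp only [map_mul, MvPolynomial.eval_X, Derivation.leibniz, smul_eq_mul, map_add]
    rcases i with j | j
    · have := h.fun_mul (hasDerivAt_iteratedDeriv hq j)
      refine this.congr_deriv ?_
      simp [dx]; ring
    · have := h.fun_mul (hasDerivAt_iteratedDeriv hr j)
      refine this.congr_deriv ?_
      simp [dx]; ring

/-- A normalized solution of the Lax equation is given by the universal differential
polynomials. -/
theorem coeff_eq_evalAt_laxCoeff {U : Set ℝ} (hU : IsOpen U) {q r : ℝ → ℂ}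
    {a b c : ℝ → PowerSeries ℂ}
    (hq : ∀ y ∈ U, ContDiffAt ℝ ∞ q y) (hr : ∀ y ∈ U, ContDiffAt ℝ ∞ r y)
    (ha0 : ∀ y ∈ U, PowerSeries.coeff 0 (a y) = 1)
    (hb0 : ∀ y ∈ U, PowerSeries.coeff 0 (b y) = 0)
    (hc0 : ∀ y ∈ U, PowerSeries.coeff 0 (c y) = 0)
    (hsq : ∀ y ∈ U, a y * a y + b y * c y = 1)
    (hb : ∀ y ∈ U, ∀ j, HasDerivAt (fun z => PowerSeries.coeff j (b z))
      (2 * PowerSeries.coeff (j + 1) (b y) - 2 * q y * PowerSeries.coeff j (a y)) y)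
    (hc : ∀ y ∈ U, ∀ j, HasDerivAt (fun z => PowerSeries.coeff j (c z))
      (-2 * PowerSeries.coeff (j + 1) (c y) + 2 * r y * PowerSeries.coeff j (a y)) y)
    (j : ℕ) : ∀ y ∈ U, PowerSeries.coeff j (a y) = evalAt (laxCoeff j).1 q r y ∧
      PowerSeries.coeff j (b y) = evalAt (laxCoeff j).2.1 q r y ∧
      PowerSeries.coeff j (c y) = evalAt (laxCoeff j).2.2 q r y := by
  induction j using Nat.strong_induction_on with
  | _ j ih =>
    intro y hy
    cases j with
    | zero =>
      rw [show laxCoeff 0 = (1, 0, 0) by rw [laxCoeff]]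
      simp [evalAt, ha0 y hy, hb0 y hy, hc0 y hy]
    | succ j =>
      have ev2 : ∀ p : DiffPoly, evalAt (2 * p) q r y = 2 * evalAt p q r y := fun p => by
        simp [evalAt]
      refine ⟨?_, ?_, ?_⟩
      -- Both S and the universal series square to 1. Comparing coefficient j + 1, all terms but
      -- 2a_{j+1} agree by induction.
      · have h := congrArg (PowerSeries.coeff (j + 1)) (hsq y hy)
        rw [map_add, coeff_succ_mul, coeff_succ_mul, ha0 y hy, hb0 y hy, hc0 y hy,
          PowerSeries.coeff_one, if_neg (Nat.succ_ne_zero j)] at h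
        have h' := congrArg (fun p => evalAt (PowerSeries.coeff (j + 1) p) q r y) laxA_sq_add
        simp only [map_add, coeff_succ_mul, PowerSeries.coeff_one, if_neg (Nat.succ_ne_zero j),
          laxA, laxB, laxC, PowerSeries.coeff_mk] at h'
        rw [show laxCoeff 0 = (1, 0, 0) by rw [laxCoeff]] at h'
        simp only [evalAt, map_add, map_mul, map_sum, map_one, map_zero] at h'
        have s1 : ∑ i : Fin j, PowerSeries.coeff (i + 1) (a y) * PowerSeries.coeff (j - i) (a y) =
            ∑ i : Fin j, evalAt (laxCoeff (i + 1)).1 q r y * evalAt (laxCoeff (j - i)).1 q r y :=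
          Finset.sum_congr rfl fun i _ => by
            rw [(ih (i + 1) (by omega) y hy).1, (ih (j - i) (by omega) y hy).1]
        have s2 : ∑ i : Fin j, PowerSeries.coeff (i + 1) (b y) * PowerSeries.coeff (j - i) (c y) =
            ∑ i : Fin j, evalAt (laxCoeff (i + 1)).2.1 q r y *
              evalAt (laxCoeff (j - i)).2.2 q r y :=
          Finset.sum_congr rfl fun i _ => by
            rw [(ih (i + 1) (by omega) y hy).2.1, (ih (j - i) (by omega) y hy).2.2]
        rw [s1, s2] at h
        simp only [evalAt] at h ⊢
        linear_combination (h - h') / 2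
      -- The derivative of b_j is computed twice, which requires the induction hypothesis on a whole
      -- neighbourhood of y.
      · have hd := (hb y hy j).unique ((hasDerivAt_evalAt (laxCoeff j).2.1 (hq y hy)
          (hr y hy)).congr_of_eventuallyEq
          (by filter_upwards [hU.mem_nhds hy] with z hz using (ih j (by omega) z hz).2.1))
        have he := congrArg (fun p => evalAt p q r y) (two_mul_laxCoeff_b_succ j)
        simp only [evalAt, map_add, map_mul, qVar, MvPolynomial.eval_X, Sum.elim_inl,
          iteratedDeriv_zero, map_ofNat] at he
        rw [(ih j (by omega) y hy).1] at hd
        simp only [evalAt] at hd ⊢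
        linear_combination (hd - he) / 2
      · have hd := (hc y hy j).unique ((hasDerivAt_evalAt (laxCoeff j).2.2 (hq y hy)
          (hr y hy)).congr_of_eventuallyEq
          (by filter_upwards [hU.mem_nhds hy] with z hz using (ih j (by omega) z hz).2.2))
        have he := congrArg (fun p => evalAt p q r y) (two_mul_laxCoeff_c_succ j)
        simp only [evalAt, map_add, map_mul, map_neg, rVar, MvPolynomial.eval_X, Sum.elim_inr,
          iteratedDeriv_zero, map_ofNat] at he
        rw [(ih j (by omega) y hy).1] at hd
        simp only [evalAt] at hd ⊢
        linear_combination -(hd + he) / 2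

end Identification

/-! ### The exponentials φ and ψ: space and time derivatives, smoothness. -/

section Exponentials

open Matrix
open scoped Matrix.Norms.Operator

variable {N : ℕ}

/-- `M ↦ M v` as a continuous linear map. -/
def mulVecCLM (v : Fin N → ℂ) : Matrix (Fin N) (Fin N) ℂ →L[ℝ] (Fin N → ℂ) :=
  LinearMap.toContinuousLinearMap
    { toFun := fun M => M *ᵥ v
      map_add' := fun M M' => add_mulVec M M' v
      map_smul' := fun c M => smul_mulVec c M v }

theorem contDiff_matrix_exp :
    ContDiff ℝ ∞ (NormedSpace.exp : Matrix (Fin N) (Fin N) ℂ → Matrix (Fin N) (Fin N) ℂ) :=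
  contDiff_iff_contDiffAt.mpr fun x => (NormedSpace.exp_analytic (𝕂 := ℝ) x).contDiffAt

theorem hasDerivAt_exp_smul_add_mulVec {A B : Matrix (Fin N) (Fin N) ℂ} (h : Commute A B)
    (v : Fin N → ℂ) (x : ℝ) :
    HasDerivAt (fun t : ℝ => NormedSpace.exp (t • A + B) *ᵥ v)
      (A *ᵥ (NormedSpace.exp (x • A + B) *ᵥ v)) x := by
  have h2 : ∀ t : ℝ, NormedSpace.exp (t • A + B) = NormedSpace.exp (t • A) * NormedSpace.exp B :=
    fun t => Matrix.exp_add_of_commute _ _ (h.smul_left t)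
  have h1 : HasDerivAt (fun t : ℝ => NormedSpace.exp (t • A + B))
      (A * NormedSpace.exp (x • A + B)) x := by
    simp only [h2, ← mul_assoc]
    exact (hasDerivAt_exp_smul_const' (𝕂 := ℝ) A x).mul_const (NormedSpace.exp B)
  have := (mulVecCLM v).hasFDerivAt.comp_hasDerivAt x h1
  rw [mulVec_mulVec]
  exact this

theorem contDiff_exp_mulVec {E : Type*} [NormedAddCommGroup E] [NormedSpace ℝ E]
    {F : E → Matrix (Fin N) (Fin N) ℂ} (hF : ContDiff ℝ ∞ F) (v : Fin N → ℂ) :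
    ContDiff ℝ ∞ fun e => NormedSpace.exp (F e) *ᵥ v :=
  (mulVecCLM v).contDiff.comp (contDiff_matrix_exp.comp hF)

variable (A : Matrix (Fin N) (Fin N) ℂ)

/-- Without summability the sum is 0 by convention, so the x-derivatives of φ and ψ need no
convergence hypothesis. -/
theorem commute_tsum (t : ℕ → ℂ) : Commute A (∑' j : ℕ, t (j + 1) • A ^ (2 * (j + 1))) := by
  by_cases h : Summable fun j : ℕ => t (j + 1) • A ^ (2 * (j + 1))
  · rw [Commute, SemiconjBy, ← h.tsum_mul_left, ← h.tsum_mul_right]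
    refine tsum_congr fun j => ?_
    rw [mul_smul_comm, smul_mul_assoc, ← pow_succ, ← pow_succ']
  · rw [tsum_eq_zero_of_not_summable h]
    exact Commute.zero_right A

theorem commute_exponent (t : ℕ → ℂ) (x : ℝ) : Commute A (exponent A t x) :=
  ((Commute.refl A).smul_right _).add_right (commute_tsum A t)

theorem hasDerivAt_phi (C : Fin N → ℂ) (t : ℕ → ℂ) (x : ℝ) :
    HasDerivAt (phi A C t) (A *ᵥ phi A C t x) x := by
  have := hasDerivAt_exp_smul_add_mulVec (commute_tsum A t) C x
  simp only [← Complex.coe_smul] at this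
  exact this

theorem hasDerivAt_psi (D : Fin N → ℂ) (t : ℕ → ℂ) (x : ℝ) :
    HasDerivAt (psi A D t) (-(A *ᵥ psi A D t x)) x := by
  have := hasDerivAt_exp_smul_add_mulVec (commute_tsum A t).neg_left.neg_right D x
  simp only [← Complex.coe_smul, smul_neg, ← neg_add, neg_mulVec] at this
  exact this

theorem iteratedDeriv_phi (C : Fin N → ℂ) (t : ℕ → ℂ) (i : Fin N) (j : ℕ) :
    iteratedDeriv j (fun y => phi A C t y i) = fun x => (A ^ j *ᵥ phi A C t x) i := by
  induction j with
  | zero => simp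
  | succ j ih =>
    rw [iteratedDeriv_succ, ih]
    ext x
    rw [(hasDerivAt_pi.mp (hasDerivAt_mulVec (A ^ j) (hasDerivAt_phi A C t x)) i).deriv,
      mulVec_mulVec, pow_succ]

theorem iteratedDeriv_psi (D : Fin N → ℂ) (t : ℕ → ℂ) (i : Fin N) (j : ℕ) :
    iteratedDeriv j (fun y => psi A D t y i) = fun x => ((-A) ^ j *ᵥ psi A D t x) i := by
  induction j with
  | zero => simp
  | succ j ih =>
    rw [iteratedDeriv_succ, ih]
    ext x
    rw [(hasDerivAt_pi.mp (hasDerivAt_mulVec ((-A) ^ j) (hasDerivAt_psi A D t x)) i).deriv,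
      ← neg_mulVec, mulVec_mulVec, pow_succ]

/-- Since ∂ₓ acts on φ as A and on ψ as -A, the double Wronskian is a Krylov determinant. -/
theorem W_eq_det (C D : Fin N → ℂ) (p : ℕ) (τ : ℕ → ℝ) (x : ℝ) :
    W A C D p τ x = (krylovMatrix A p (phi A C (times τ) x) (psi A D (times τ) x)).det := by
  rw [W, doubleWronskian, krylovMatrix]
  simp only [iteratedDeriv_phi, iteratedDeriv_psi]

variable {A}

/-- The factor in `t_{2k} = κ τ_{2k}`. -/
def timeFactor (k : ℕ) : ℂ := -((2 : ℂ) ^ (2 * k) / 2) * Complex.I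

/-- Changing τ_{2k} alters the single summand with index k - 1, so the exponent is affine in that
time. -/
theorem exponent_update {τ : ℕ → ℝ}
    (hτ : Summable fun j : ℕ => times τ (j + 1) • A ^ (2 * (j + 1))) {k : ℕ} (hk : 1 ≤ k)
    (s x : ℝ) :
    exponent A (times (Function.update τ k s)) x =
      s • (timeFactor k • A ^ (2 * k)) +
        (exponent A (times τ) x - τ k • (timeFactor k • A ^ (2 * k))) := by
  obtain ⟨k, rfl⟩ : ∃ l, k = l + 1 := ⟨k - 1, by omega⟩
  have h : ∀ j, times (Function.update τ (k + 1) s) (j + 1) • A ^ (2 * (j + 1)) =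
      times τ (j + 1) • A ^ (2 * (j + 1)) +
        Pi.single (M := fun _ => Matrix (Fin N) (Fin N) ℂ) k
          ((s - τ (k + 1)) • (timeFactor (k + 1) • A ^ (2 * (k + 1)))) j := by
    intro j
    by_cases hj : j = k
    · subst hj
      rw [Pi.single_eq_same, times, times, Function.update_self, timeFactor, ← Complex.coe_smul,
        smul_smul, ← add_smul]
      congr 1
      push_cast
      ring
    · rw [Pi.single_eq_of_ne hj, add_zero, times, times,
        Function.update_of_ne (by simpa using hj)]
  rw [exponent, exponent, tsum_congr h, hτ.tsum_add ⟨_, hasSum_pi_single _ _⟩, tsum_pi_single,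
    sub_smul]
  abel

theorem commute_smul_exponent {τ : ℕ → ℝ} (k : ℕ) (c : ℂ) (x d : ℝ) :
    Commute (c • A ^ k) (exponent A (times τ) x - d • (c • A ^ k)) :=
  ((((commute_exponent A (times τ) x).pow_left k).smul_left c)).sub_right
    ((Commute.refl _).smul_right d)

theorem hasDerivAt_phi_time {τ : ℕ → ℝ}
    (hτ : Summable fun j : ℕ => times τ (j + 1) • A ^ (2 * (j + 1))) {k : ℕ} (hk : 1 ≤ k)
    (C : Fin N → ℂ) (x : ℝ) :
    HasDerivAt (fun s => phi A C (times (Function.update τ k s)) x)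
      (timeFactor k • (A ^ (2 * k) *ᵥ phi A C (times τ) x)) (τ k) := by
  have := hasDerivAt_exp_smul_add_mulVec
    (commute_smul_exponent (τ := τ) (2 * k) (timeFactor k) x (τ k) (A := A)) C (τ k)
  simp only [← exponent_update hτ hk, Function.update_eq_self, smul_mulVec] at this
  exact this

theorem hasDerivAt_psi_time {τ : ℕ → ℝ}
    (hτ : Summable fun j : ℕ => times τ (j + 1) • A ^ (2 * (j + 1))) {k : ℕ} (hk : 1 ≤ k)
    (D : Fin N → ℂ) (x : ℝ) :
    HasDerivAt (fun s => psi A D (times (Function.update τ k s)) x)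
      (-(timeFactor k • (A ^ (2 * k) *ᵥ psi A D (times τ) x))) (τ k) := by
  have := hasDerivAt_exp_smul_add_mulVec
    (commute_smul_exponent (τ := τ) (2 * k) (timeFactor k) x (τ k) (A := A)).neg_left.neg_right
      D (τ k)
  have e : ∀ s : ℝ, s • -(timeFactor k • A ^ (2 * k)) +
      -(exponent A (times τ) x - τ k • (timeFactor k • A ^ (2 * k))) =
      -exponent A (times (Function.update τ k s)) x := fun s => by
    rw [exponent_update hτ hk, smul_neg, neg_add]
  simp only [e, Function.update_eq_self, smul_mulVec, neg_mulVec] at this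
  exact this

theorem contDiff_exponent {τ : ℕ → ℝ}
    (hτ : Summable fun j : ℕ => times τ (j + 1) • A ^ (2 * (j + 1))) {k : ℕ} (hk : 1 ≤ k) :
    ContDiff ℝ ∞ fun p : ℝ × ℝ => exponent A (times (Function.update τ k p.2)) p.1 := by
  simp only [exponent_update hτ hk]
  simp only [exponent, Complex.coe_smul]
  exact (contDiff_snd.smul contDiff_const).add
    (((contDiff_fst.smul contDiff_const).add contDiff_const).sub contDiff_const)

theorem contDiff_W {τ : ℕ → ℝ}
    (hτ : Summable fun j : ℕ => times τ (j + 1) • A ^ (2 * (j + 1))) {k : ℕ} (hk : 1 ≤ k)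
    (C D : Fin N → ℂ) (m : ℕ) :
    ContDiff ℝ ∞ fun p : ℝ × ℝ => W A C D m (Function.update τ k p.2) p.1 := by
  simp only [W_eq_det]
  have hlin : ∀ (B : Matrix (Fin N) (Fin N) ℂ) {v : ℝ × ℝ → Fin N → ℂ}, ContDiff ℝ ∞ v →
      ∀ i, ContDiff ℝ ∞ fun p => (B *ᵥ v p) i := fun B v hv i => by
    simp only [mulVec, dotProduct]
    exact ContDiff.sum fun l _ => contDiff_const.mul (contDiff_pi.mp hv l)
  refine contDiff_iff_contDiffAt.mpr fun p => contDiffAt_det fun i j => ContDiff.contDiffAt ?_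
  simp only [krylovMatrix, Matrix.of_apply]
  split_ifs
  · exact hlin _ (contDiff_exp_mulVec (contDiff_exponent hτ hk) C) i
  · exact hlin _ (contDiff_exp_mulVec (contDiff_exponent hτ hk).neg D) i

end Exponentials

/-! ### The symmetry ψ(x) = T φ*(-x). -/

section Reflection

open Matrix

variable {N : ℕ} {A T : Matrix (Fin N) (Fin N) ℂ}

theorem star_mulVec_eq (M : Matrix (Fin N) (Fin N) ℂ) (v : Fin N → ℂ) :
    star (M *ᵥ v) = M.map star *ᵥ star v := by
  ext i
  simp [mulVec, dotProduct]

theorem mul_pow_map_star (hAT : A * T = T * A.map star) (j : ℕ) :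
    T * (A ^ j).map star = A ^ j * T := by
  have hp : (A ^ j).map star = (A.map star) ^ j :=
    map_pow (starRingEnd ℂ).mapMatrix A j
  rw [hp]
  exact ((show SemiconjBy T (A.map star) A from hAT.symm).pow_right j).eq

theorem star_times (τ : ℕ → ℝ) (j : ℕ) : star (times τ j) = -times τ j := by
  simp [times]

/-- T intertwines A* with A. The sign arises from x ↦ -x in the first term and from the imaginary
times t_{2j} in the sum. -/
theorem mul_exponent_map_star (hAT : A * T = T * A.map star) {τ : ℕ → ℝ}
    (hτ : Summable fun j : ℕ => times τ (j + 1) • A ^ (2 * (j + 1))) (x : ℝ) :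
    T * (exponent A (times τ) (-x)).map star = -exponent A (times τ) x * T := by
  let g : Matrix (Fin N) (Fin N) ℂ →+ Matrix (Fin N) (Fin N) ℂ :=
    { toFun := fun M => T * M.map star
      map_zero' := by simp
      map_add' := fun M M' => by
        rw [Matrix.map_add _ (fun a b => star_add a b), mul_add] }
  have hg : Continuous g := continuous_const.matrix_mul (continuous_id.matrix_map continuous_star)
  have hsm : ∀ (c : ℂ) (j : ℕ), g (c • A ^ j) = star c • (A ^ j * T) := fun c j => by
    rw [← mul_pow_map_star hAT, ← mul_smul_comm]
    change T * _ = T * _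
    congr 1
    ext; simp
  have h1 : g (((-x : ℝ) : ℂ) • A) = -((x : ℂ) • A * T) := by
    have := hsm ((-x : ℝ) : ℂ) 1
    rw [pow_one] at this
    rw [this, smul_mul_assoc, ← neg_smul]
    simp
  change g (exponent A (times τ) (-x)) = _
  rw [exponent, exponent, map_add, h1, hτ.map_tsum g hg, neg_mul, add_mul, ← hτ.tsum_mul_right,
    neg_add, ← tsum_neg]
  congr 1
  refine tsum_congr fun j => ?_
  rw [hsm, star_times, neg_smul, smul_mul_assoc]

theorem isUnit_of_mul_map_star {δ : ℂ} (hδ : δ ≠ 0)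
    (hT : T * T.map star = δ • (1 : Matrix (Fin N) (Fin N) ℂ)) : IsUnit T := by
  refine IsUnit.of_mul_eq_one (δ⁻¹ • T.map star) ?_
  rw [mul_smul_comm, hT, smul_smul, inv_mul_cancel₀ hδ, one_smul]

open scoped Matrix.Norms.Operator in
theorem map_star_exp (M : Matrix (Fin N) (Fin N) ℂ) :
    (NormedSpace.exp M).map star = NormedSpace.exp (M.map star) :=
  NormedSpace.map_exp (starRingEnd ℂ).mapMatrix
    (continuous_id.matrix_map continuous_star) M

theorem psi_eq_mulVec_star_phi {δ : ℂ} (hδ : δ ≠ 0) (hAT : A * T = T * A.map star)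
    (hT : T * T.map star = δ • (1 : Matrix (Fin N) (Fin N) ℂ)) {C D : Fin N → ℂ}
    (hD : D = T *ᵥ star C) {τ : ℕ → ℝ}
    (hτ : Summable fun j : ℕ => times τ (j + 1) • A ^ (2 * (j + 1))) (x : ℝ) :
    psi A D (times τ) x = T *ᵥ star (phi A C (times τ) (-x)) := by
  have hu := isUnit_of_mul_map_star hδ hT
  have hdet := (Matrix.isUnit_iff_isUnit_det T).mp hu
  have hE : -exponent A (times τ) x = T * (exponent A (times τ) (-x)).map star * T⁻¹ := by
    rw [mul_exponent_map_star hAT hτ, mul_assoc, Matrix.mul_nonsing_inv T hdet, mul_one]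
  rw [psi, phi, hE, Matrix.exp_conj _ _ hu, star_mulVec_eq, map_star_exp, hD, mulVec_mulVec,
    mulVec_mulVec, mul_assoc, Matrix.nonsing_inv_mul T hdet, mul_one]

open Polynomial

theorem mulVec_star_revEval (hAT : A * T = T * A.map star) {d : ℕ} {f : ℂ[X]}
    (hf : f.natDegree ≤ d) (v : Fin N → ℂ) :
    T *ᵥ star (revEval A d f *ᵥ v) = revEval A d (f.map (starRingEnd ℂ)) *ᵥ (T *ᵥ star v) := by
  rw [revEval_eq_sum A hf, revEval_eq_sum A (natDegree_map_le.trans hf)]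
  simp only [sum_mulVec, smul_mulVec, star_sum, coeff_map]
  rw [← mulVecLin_apply T (∑ _ ∈ _, _), map_sum]
  refine Finset.sum_congr rfl fun j _ => ?_
  rw [mulVecLin_apply, mulVec_mulVec, ← mul_pow_map_star hAT, star_smul, star_mulVec_eq,
    mulVec_smul, mulVec_mulVec]
  rfl

end Reflection

/-! ### Action of the symmetry on the dressing matrix. -/

section ReflectedDressing

open Matrix Polynomial

variable {n : ℕ} {A T : Matrix (Fin (2 * n + 2)) (Fin (2 * n + 2)) ℂ} {δ : ℂ}
  {φ ψ φ' ψ' : Fin (2 * n + 2) → ℂ}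

/-- The primed vectors are the values at -x. Conjugating and applying T turns an annihilating row
(f, g) at -x into (δ g*, f*) at x. -/
theorem revEval_reflected (hAT : A * T = T * A.map star)
    (hψ : T *ᵥ star φ' = ψ) (hφ : T *ᵥ star ψ' = δ • φ) {d : ℕ} {f g : ℂ[X]}
    (hf : f.natDegree ≤ d) (hg : g.natDegree ≤ d)
    (h : revEval A d f *ᵥ φ' + revEval A d g *ᵥ ψ' = 0) :
    revEval A d (C δ * g.map (starRingEnd ℂ)) *ᵥ φ +
      revEval A d (f.map (starRingEnd ℂ)) *ᵥ ψ = 0 := by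
  have := congrArg (fun v => T *ᵥ star v) h
  simp only [star_add, mulVec_add, mulVec_star_revEval hAT hf, mulVec_star_revEval hAT hg, hψ, hφ,
    star_zero, mulVec_zero, mulVec_smul] at this
  rw [revEval_C_mul, smul_mulVec]
  exact (add_comm _ _).trans this

theorem det_krylovMatrix_reflected_ne_zero (hδ : δ ≠ 0) (hAT : A * T = T * A.map star)
    (hψ : T *ᵥ star φ' = ψ) (hφ : T *ᵥ star ψ' = δ • φ)
    (hdet : (krylovMatrix A (n + 1) φ ψ).det ≠ 0) :
    (krylovMatrix A (n + 1) φ' ψ').det ≠ 0 := by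
  rw [det_krylovMatrix_ne_zero_iff] at hdet ⊢
  intro f g hf hg h
  obtain ⟨h1, h2⟩ := hdet _ _ ((natDegree_C_mul_le _ _).trans (natDegree_map_le.trans hg))
    (natDegree_map_le.trans hf) (revEval_reflected hAT hψ hφ hf hg h)
  have hinj : Function.Injective (starRingEnd ℂ) := star_injective
  exact ⟨(Polynomial.map_eq_zero_iff hinj).mp h2, (Polynomial.map_eq_zero_iff hinj).mp
    ((mul_eq_zero.mp h1).resolve_left (by simpa using hδ))⟩

/-- The reflected first row of G at -x has the normalization of the second row at x. Their
difference has λ-degree at most n and annihilates (φ, ψ), so the rows coincide. -/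
theorem coeff_one_dressC_reflected (hδ : δ ≠ 0) (hAT : A * T = T * A.map star)
    (hψ : T *ᵥ star φ' = ψ) (hφ : T *ᵥ star ψ' = δ • φ)
    (hdet : (krylovMatrix A (n + 1) φ ψ).det ≠ 0) :
    (dressC A φ ψ).coeff 1 = δ * star ((dressB A φ' ψ').coeff 1) := by
  have hdet' := det_krylovMatrix_reflected_ne_zero hδ hAT hψ hφ hdet
  have h1 := revEval_reflected hAT hψ hφ (natDegree_dressA_le A φ' ψ')
    (natDegree_dressB_le A φ' ψ') (revEval_dress_first hdet')
  have h2 := revEval_dress_second hdet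
  set w' := krylovSolve A φ' ψ' (A ^ (n + 1) *ᵥ φ') with hw'
  set w := krylovSolve A φ ψ (A ^ (n + 1) *ᵥ ψ) with hw
  have e1 : C δ * (dressB A φ' ψ').map (starRingEnd ℂ) - dressC A φ ψ =
      X * (C δ * (botPoly w').map (starRingEnd ℂ) - topPoly w) := by
    simp only [dressB, dressC, ← hw, ← hw', Polynomial.map_mul, Polynomial.map_X]
    ring
  have e2 : (dressA A φ' ψ').map (starRingEnd ℂ) - dressD A φ ψ =
      X * ((topPoly w').map (starRingEnd ℂ) - botPoly w) := by
    simp only [dressA, dressD, ← hw, ← hw', Polynomial.map_mul, Polynomial.map_X,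
      Polynomial.map_add, Polynomial.map_one]
    ring
  have d1 : (C δ * (botPoly w').map (starRingEnd ℂ) - topPoly w).natDegree ≤ n :=
    (natDegree_sub_le _ _).trans (max_le ((natDegree_C_mul_le _ _).trans
      (natDegree_map_le.trans (natDegree_botPoly_le _))) (natDegree_topPoly_le _))
  have d2 : ((topPoly w').map (starRingEnd ℂ) - botPoly w).natDegree ≤ n :=
    (natDegree_sub_le _ _).trans (max_le (natDegree_map_le.trans (natDegree_topPoly_le _))
      (natDegree_botPoly_le _))
  obtain ⟨h0, -⟩ := det_krylovMatrix_ne_zero_iff.mp hdet _ _ d1 d2 (by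
    rw [← revEval_X_mul d1, ← revEval_X_mul d2, ← e1, ← e2, revEval_sub, revEval_sub, sub_mulVec,
      sub_mulVec]
    linear_combination h1 - h2)
  rw [h0, mul_zero] at e1
  have := congrArg (fun p : ℂ[X] => p.coeff 1) e1
  simp only [coeff_sub, coeff_C_mul, coeff_map, coeff_zero] at this
  exact (sub_eq_zero.mp this).symm

end ReflectedDressing

/-! ### The time derivative of q in terms of b_{2k+1}. -/

section Solutions

open Matrix Filter Topology

variable {n : ℕ} {A : Matrix (Fin (2 * n + 2)) (Fin (2 * n + 2)) ℂ} {C D : Fin (2 * n + 2) → ℂ}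

theorem qSol_eq (τ : ℕ → ℝ) (x : ℝ) :
    qSol A C D τ x = -2 * (dressB A (phi A C (times τ) x) (psi A D (times τ) x)).coeff 1 := by
  rw [qSol, coeff_one_dressB, W_eq_det, W_eq_det]
  ring

theorem rSol_eq (τ : ℕ → ℝ) (x : ℝ) :
    rSol A C D τ x = 2 * (dressC A (phi A C (times τ) x) (psi A D (times τ) x)).coeff 1 := by
  rw [rSol, coeff_one_dressC, W_eq_det, W_eq_det]
  ring

variable {τ : ℕ → ℝ}

theorem contDiffAt_const_mul_div {E : Type*} [NormedAddCommGroup E] [NormedSpace ℝ E] (c : ℂ)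
    {f g : E → ℂ} {x : E} (hf : ContDiff ℝ ∞ f) (hg : ContDiff ℝ ∞ g) (hx : g x ≠ 0) :
    ContDiffAt ℝ ∞ (fun e => c * f e / g e) x := by
  simp only [div_eq_mul_inv]
  exact (contDiffAt_const.mul hf.contDiffAt).mul (hg.contDiffAt.inv hx)

theorem contDiffAt_qSol
    (hτ : Summable fun j : ℕ => times τ (j + 1) • A ^ (2 * (j + 1)))
    {k : ℕ} (hk : 1 ≤ k) {x : ℝ} (hx : W A C D (n + 1) τ x ≠ 0) :
    ContDiffAt ℝ ∞ (fun p : ℝ × ℝ => qSol A C D (Function.update τ k p.2) p.1) (x, τ k) :=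
  contDiffAt_const_mul_div 2 (contDiff_W hτ hk C D (n + 2)) (contDiff_W hτ hk C D (n + 1))
    (by simpa using hx)

theorem contDiff_W_space
    (hτ : Summable fun j : ℕ => times τ (j + 1) • A ^ (2 * (j + 1)))
    (m : ℕ) : ContDiff ℝ ∞ (W A C D m τ) := by
  have := (contDiff_W hτ le_rfl C D m).comp (contDiff_id.prodMk (contDiff_const (c := τ 1)))
  simpa [Function.comp_def] using this

theorem hasDerivAt_qSol_time
    (hτ : Summable fun j : ℕ => times τ (j + 1) • A ^ (2 * (j + 1)))
    {k : ℕ} (hk : 1 ≤ k) {x : ℝ} (hx : W A C D (n + 1) τ x ≠ 0) :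
    HasDerivAt (fun s => qSol A C D (Function.update τ k s) x)
      (2 * timeFactor k * evalAt (laxCoeff (2 * k + 1)).2.1 (qSol A C D τ) (rSol A C D τ) x)
      (τ k) := by
  -- The identification of S differentiates in x, so it is carried out on the open set where the
  -- denominator is nonzero.
  have hU : IsOpen {y | W A C D (n + 1) τ y ≠ 0} :=
    isOpen_ne_fun (contDiff_W_space hτ (n + 1)).continuous continuous_const
  have hdet : ∀ y ∈ {y | W A C D (n + 1) τ y ≠ 0},
      (krylovMatrix A (n + 1) (phi A C (times τ) y) (psi A D (times τ) y)).det ≠ 0 :=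
    fun y hy => by rw [← W_eq_det]; exact hy
  have key := (coeff_eq_evalAt_laxCoeff hU (q := qSol A C D τ) (r := rSol A C D τ)
    (a := fun y => conjA A (phi A C (times τ) y) (psi A D (times τ) y))
    (b := fun y => conjB A (phi A C (times τ) y) (psi A D (times τ) y))
    (c := fun y => conjC A (phi A C (times τ) y) (psi A D (times τ) y))
    (fun y hy => contDiffAt_const_mul_div 2 (contDiff_W_space hτ (n + 2))
      (contDiff_W_space hτ (n + 1)) hy)
    (fun y hy => contDiffAt_const_mul_div (-2) (contDiff_W_space hτ n)
      (contDiff_W_space hτ (n + 1)) hy)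
    (fun y _ => by
      rw [PowerSeries.coeff_zero_eq_constantCoeff_apply]; exact constantCoeff_conjA _ _ _)
    (fun y _ => by
      rw [PowerSeries.coeff_zero_eq_constantCoeff_apply]; exact constantCoeff_conjB _ _ _)
    (fun y _ => by
      rw [PowerSeries.coeff_zero_eq_constantCoeff_apply]; exact constantCoeff_conjC _ _ _)
    (fun y _ => conj_sq _ _ _)
    (fun y hy j => (hasDerivAt_coeff_conj (hasDerivAt_phi A C (times τ) y)
      (hasDerivAt_psi A D (times τ) y) (hdet y hy) (qSol_eq τ y) (rSol_eq τ y) j).1)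
    (fun y hy j => (hasDerivAt_coeff_conj (hasDerivAt_phi A C (times τ) y)
      (hasDerivAt_psi A D (times τ) y) (hdet y hy) (qSol_eq τ y) (rSol_eq τ y) j).2)
    (2 * k + 1) x hx).2.1
  have hd := hasDerivAt_coeff_one_dressB (A := A) (m := 2 * k) (κ := timeFactor k) (y := τ k)
    (Φ := fun s => phi A C (times (Function.update τ k s)) x)
    (Ψ := fun s => psi A D (times (Function.update τ k s)) x)
    (by simpa using hasDerivAt_phi_time hτ hk C x)
    (by simpa using hasDerivAt_psi_time hτ hk D x) (by simpa using hdet x hx)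
  simp only [Function.update_eq_self] at hd
  rw [key] at hd
  simp only [qSol_eq (τ := Function.update τ k _)]
  exact (hd.const_mul (-2)).congr_deriv (by ring)

end Solutions

end NonlocalNLS

end

theorem theorem1 (n : ℕ) (A T : Matrix (Fin (2 * n + 2)) (Fin (2 * n + 2)) ℂ)
    (C D : Fin (2 * n + 2) → ℂ) (ε δ : ℂ)
    (hsign : (ε = 1 ∧ δ = -1) ∨ (ε = -1 ∧ δ = 1))
    (hAT : A * T = T * A.map star)
    (hT : T * T.map star = δ • (1 : Matrix (Fin (2 * n + 2)) (Fin (2 * n + 2)) ℂ))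
    (hD : D = T.mulVec (star C))
    (τ : ℕ → ℝ)
    (hτ : Summable fun j : ℕ => NonlocalNLS.times τ (j + 1) • A ^ (2 * (j + 1))) :
    (∀ x : ℝ, NonlocalNLS.psi A D (NonlocalNLS.times τ) x =
      T.mulVec (star (NonlocalNLS.phi A C (NonlocalNLS.times τ) (-x)))) ∧
    ∀ x : ℝ, NonlocalNLS.W A C D (n + 1) τ x ≠ 0 →
      NonlocalNLS.rSol A C D τ x = ε * star (NonlocalNLS.qSol A C D τ (-x)) ∧
      ∀ k : ℕ, 1 ≤ k → NonlocalNLS.SolvesAt ε k (NonlocalNLS.qSol A C D) τ x := by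
  open NonlocalNLS in
  have hδ : δ ≠ 0 := by rcases hsign with ⟨-, h⟩ | ⟨-, h⟩ <;> simp [h]
  have hεδ : ε = -δ := by rcases hsign with ⟨h, h'⟩ | ⟨h, h'⟩ <;> simp [h, h']
  have hψ := psi_eq_mulVec_star_phi hδ hAT hT hD hτ
  have hφ : ∀ x, T.mulVec (star (psi A D (times τ) (-x))) = δ • phi A C (times τ) x := fun x => by
    rw [hψ, star_mulVec_eq, neg_neg, star_star, Matrix.mulVec_mulVec, hT, Matrix.smul_mulVec,
      Matrix.one_mulVec]
  have hr : ∀ x, W A C D (n + 1) τ x ≠ 0 →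
      rSol A C D τ x = ε * star (qSol A C D τ (-x)) := fun x hx => by
    rw [W_eq_det] at hx
    rw [rSol_eq, qSol_eq, coeff_one_dressC_reflected hδ hAT (hψ x).symm (hφ x) hx, hεδ]
    simp only [star_mul', star_neg, star_ofNat]
    ring
  refine ⟨hψ, fun x hx => ⟨hr x hx, fun k hk => ?_⟩⟩
  have hx' : W A C D (n + 1) τ (-x) ≠ 0 := by
    rw [W_eq_det] at hx ⊢
    exact det_krylovMatrix_reflected_ne_zero hδ hAT (hψ x).symm (hφ x) hx
  refine ⟨contDiffAt_qSol hτ hk hx, contDiffAt_qSol hτ hk hx', ?_⟩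
  -- K_k involves x-derivatives of the reflected potential, so its equality with r is needed near x
  -- and not only at x.
  have hev : reflected ε (qSol A C D τ) =ᶠ[nhds x] rSol A C D τ := by
    filter_upwards [(contDiff_W_space hτ (C := C) (D := D)
      (n + 1)).continuous.continuousAt.eventually_ne hx] with y hy
    exact (hr y hy).symm
  have hcongr : evalAt (aknsFlow (2 * k)).1 (qSol A C D τ) (reflected ε (qSol A C D τ)) x =
      evalAt (aknsFlow (2 * k)).1 (qSol A C D τ) (rSol A C D τ) x := by
    simp only [evalAt, hev.iteratedDeriv_eq]
  rw [(hasDerivAt_qSol_time hτ hk hx).deriv, nlsFlow, hcongr, aknsFlow_eq]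
  simp only [evalAt, map_neg, map_mul, map_pow, map_ofNat, neg_neg, timeFactor]
  rw [(even_two_mul k).neg_pow]
  -- Both sides equal 2^(2k) b_{2k+1}: the factor -2^(2k-1) i in the times is chosen to match
  -- (-2)^(2k) in K_{2k}.
  linear_combination (-(2 : ℂ) ^ (2 * k) * MvPolynomial.eval _ (laxCoeff (2 * k + 1)).2.1) *
    Complex.I_mul_I
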